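/- Let $\Omega\subset\mathbb{R}^d$ be a bounded convex domain with smooth boundary and outer unit normal $\nu$, and let $\rho_1=\rho_2=:\rho>0$ and $\mu>0$. Consider the linear reaction–diffusion system $$\partial_t u_1-\rho_1\Delta u_1=\mu(u_2-u_1),\qquad \partial_t u_2-\rho_2\Delta u_2=\mu(u_1-u_2)\quad\text{in }\Omega,$$ with homogeneous Neumann conditions $\nabla u_i\cdot\nu=0$ on $\partial\Omega$, written as $\partial_t u+A[u]=0$ for $u=(u_1,u_2)$, and the entropy $$H[u]=\int_\Omega\sum_{i=1}^2u_i(\log u_i-1)\,dx .$$ Let $s\ge 1$, and let $(a_{ij})_{i,j=1}^s$, $(b_i)_{i=1}^s$ be real Runge–Kutta coefficients with $\sum_i b_i=1$ and, with $c_i=\sum_j a_{ij}$, $$C_{\rm RK}=2\sum_{i=1}^s b_i(1-c_i)=1 .$$ Let $u^k=(u_1^k,u_2^k)$ be smooth on $\overline\Omega$, satisfy the Neumann conditions, be (strictly) positive on $\overline\Omega$, and not be a steady state, i.e. $A[u^k]\not\equiv0$ in $\Omega$. Then there exists $\tau^k>0$ (depending on $\Omega,\rho,\mu$, the coefficients and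 $u^k$) such that for all $0<\tau<\tau^k$ and every nonnegative $u^{k-1}=(u^{k-1}_1,u^{k-1}_2)$, smooth on $\overline\Omega$ and satisfying the Neumann conditions, from which $u^k$ arises by one step of size $\tau$ of the Runge–Kutta scheme $$u^k=u^{k-1}+\tau\sum_{i=1}^sb_iK_i,\qquad K_i=-A\Big[u^{k-1}+\tau\sum_{j=1}^sa_{ij}K_j\Big]\quad(i=1,\dots,s)$$ (with $K_i$ smooth on $\overline\Omega$ and the arguments of $A$ satisfying the Neumann conditions), it holds that $$H[u^k]+\tau\int_\Omega\bigg(\rho\sum_{i=1}^2\frac{|\nabla u_i^k|^2}{u_i^k}+\mu(\log u_1^k-\log u_2^k)(u_1^k-u_2^k)\bigg)dx\le H[u^{k-1}].$$ -/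

import Mathlib

open scoped ContDiff

noncomputable section

namespace RKDiffusion

/-- Two-component functions `u = (u₁, u₂)` on `ℝᵈ`, given by their components. -/
abbrev Pair (d : ℕ) : Type := Fin 2 → EuclideanSpace ℝ (Fin d) → ℝ

/-- `g` is a smooth defining function of the set `Ω`: `Ω = {g < 0}` and the gradient of `g` has no
zero on `{g = 0}`. Then `Ω` is open, `∂Ω = {g = 0}` is a smooth hypersurface and `Ω` lies locally
on one side of it. Every bounded domain with smooth boundary has such a function. -/
structure IsDefiningFunction {d : ℕ} (Ω : Set (EuclideanSpace ℝ (Fin d)))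
    (g : EuclideanSpace ℝ (Fin d) → ℝ) : Prop where
  smooth : ContDiff ℝ ∞ g
  eq_setOf_neg : Ω = {x | g x < 0}
  gradient_ne_zero : ∀ x, g x = 0 → gradient g x ≠ 0

/-- `Ω` has smooth boundary. -/
def HasSmoothBoundary {d : ℕ} (Ω : Set (EuclideanSpace ℝ (Fin d))) : Prop :=
  ∃ g, IsDefiningFunction Ω g

/-- `ν` is the outward unit normal of `Ω` at the boundary point `x`. -/
def IsOuterUnitNormal {d : ℕ} (Ω : Set (EuclideanSpace ℝ (Fin d)))
    (x ν : EuclideanSpace ℝ (Fin d)) : Prop :=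
  x ∈ frontier Ω ∧
    ∃ g, IsDefiningFunction Ω g ∧ ν = ‖gradient g x‖⁻¹ • gradient g x

/-- The pair `u` is smooth up to the boundary and satisfies the homogeneous Neumann conditions
`∇uᵢ · ν = 0` on `∂Ω`. Functions in `C^∞(Ω̄)` are represented by smooth functions on `ℝᵈ`, of
which only the values on `Ω̄` matter. -/
structure IsSmoothNeumann {d : ℕ} (Ω : Set (EuclideanSpace ℝ (Fin d))) (u : Pair d) : Prop where
  smooth : ∀ i, ContDiff ℝ ∞ (u i)
  neumann : ∀ i x ν, IsOuterUnitNormal Ω x ν → inner ℝ (gradient (u i) x) ν = 0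

/-- The operator `A` of the system `∂ₜu + A[u] = 0`, that is, of
`∂ₜu₁ - ρ₁ Δu₁ = μ (u₂ - u₁)`, `∂ₜu₂ - ρ₂ Δu₂ = μ (u₁ - u₂)`. -/
def systemOp {d : ℕ} (ρ₁ ρ₂ μ : ℝ) (u : Pair d) : Pair d :=
  ![fun x => -(ρ₁ * Laplacian.laplacian (u 0) x + μ * (u 1 x - u 0 x)),
    fun x => -(ρ₂ * Laplacian.laplacian (u 1) x + μ * (u 0 x - u 1 x))]

/-- The stage value `u^{k-1} + τ ∑ⱼ aᵢⱼ Kⱼ` (here `w = u^{k-1}`). -/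
def stage {d s : ℕ} (a : Fin s → Fin s → ℝ) (τ : ℝ) (w : Pair d) (K : Fin s → Pair d)
    (i : Fin s) : Pair d :=
  fun l x => w l x + τ * ∑ j, a i j * K j l x

/-- `u = u^k` arises from `w = u^{k-1}` by one step of size `τ` of the Runge-Kutta scheme with
coefficients `a`, `b` for the system: there are smooth `K₁, …, K_s` such that each stage value lies
in the domain of `A` (is smooth up to the boundary and satisfies the Neumann conditions),
`Kᵢ = -A[w + τ ∑ⱼ aᵢⱼ Kⱼ]` and `u = w + τ ∑ᵢ bᵢ Kᵢ` in `Ω`. -/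
def IsRKStep {d s : ℕ} (Ω : Set (EuclideanSpace ℝ (Fin d))) (ρ₁ ρ₂ μ : ℝ)
    (a : Fin s → Fin s → ℝ) (b : Fin s → ℝ) (τ : ℝ) (w u : Pair d) : Prop :=
  ∃ K : Fin s → Pair d,
    (∀ i l, ContDiff ℝ ∞ (K i l)) ∧
    (∀ i, IsSmoothNeumann Ω (stage a τ w K i)) ∧
    (∀ i l, ∀ x ∈ Ω, K i l x = -systemOp ρ₁ ρ₂ μ (stage a τ w K i) l x) ∧
    (∀ l, ∀ x ∈ Ω, u l x = w l x + τ * ∑ i, b i * K i l x)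

/-- The number `C_RK = 2 ∑ᵢ bᵢ (1 - cᵢ)` with `cᵢ = ∑ⱼ aᵢⱼ`. -/
def cRK {s : ℕ} (a : Fin s → Fin s → ℝ) (b : Fin s → ℝ) : ℝ :=
  2 * ∑ i, b i * (1 - ∑ j, a i j)

/-- `u` is a steady state of the system: `A[u] = 0` in `Ω`. -/
def IsSteadyState {d : ℕ} (Ω : Set (EuclideanSpace ℝ (Fin d))) (ρ₁ ρ₂ μ : ℝ) (u : Pair d) :
    Prop :=
  ∀ l, ∀ x ∈ Ω, systemOp ρ₁ ρ₂ μ u l x = 0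

/-- The entropy `H[u] = ∫_Ω ∑ᵢ uᵢ (log uᵢ - 1) dx` (with `0 log 0 = 0`). -/
def entropy {d : ℕ} (Ω : Set (EuclideanSpace ℝ (Fin d))) (u : Pair d) : ℝ :=
  ∫ x in Ω, ∑ i, u i x * (Real.log (u i x) - 1)

/-- The entropy production
`∫_Ω (ρ ∑ᵢ |∇uᵢ|² / uᵢ + μ (log u₁ - log u₂) (u₁ - u₂)) dx`. -/
def entropyProduction {d : ℕ} (Ω : Set (EuclideanSpace ℝ (Fin d))) (ρ μ : ℝ) (u : Pair d) : ℝ :=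
  ∫ x in Ω, (ρ * ∑ i, ‖gradient (u i) x‖ ^ 2 / u i x +
    μ * (Real.log (u 0 x) - Real.log (u 1 x)) * (u 0 x - u 1 x))

end RKDiffusion

end

/-!
The proof compares `H[w]` with `H[u]` by duality. For every pair `ψ` of functions, Fenchel's
inequality gives `H[w] ≥ ⟨ψ, w⟩ - ∫ ∑ exp ψᵢ`, with equality for `ψ = log w`. As formally
`w = u + τ A u + ½ τ² A² u + …` when `cRK = 1`, the right choice is `ψ ≈ φ + τ A u / u` with
`φ = log u`, and then the bound reads `H[u] + τ P[u] + ½ τ² Q + o(τ²)`, where `P` is the entropy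
production and `Q = ⟨A φ, A u⟩ + ∫ ∑ (A u)ᵢ² / uᵢ`.

* `Q` is the second derivative of the entropy along the flow of the system. It is a sum of a heat
  part, bounded below by `2 ∫ u |D²φ|²` thanks to Bochner's formula and the convexity of the domain
  (`two_mul_int_exp_mul_hessSq_le`), a reaction part, and a cross term which for equal diffusion
  coefficients is a weighted Dirichlet integral (`int_cross_term`). Hence `Q > 0` unless `u` is a
  steady state (`second_derivative_pos`).

* Neither `w` nor the stages are controlled by `u`: high frequencies, for which `τ A` is not small,
  can be arbitrary up to the sign of `w`. So nothing is expanded in `w`. Instead `⟨ψ, w⟩` is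
  computed exactly. Moving all operators to the test pair and eliminating the stages by Cramer's
  rule turns the scheme into `⟨p(τA) ψ, w⟩ = ⟨q(τA) ψ, u⟩` with polynomials `p`, `q`
  (`exists_elimination`), and `p` is inverted up to a remainder divisible by `(τA)⁵`. The remainder
  is small in the supremum norm, while `w ≥ 0` has the same mass as `u`.

* This needs test pairs all of whose images under `A`, …, `Aⁿ` satisfy the Neumann conditions,
  whereas `A φ` need not satisfy them. In a boundary layer of width `h`, `φ` is changed by
  `O(h³)` so that they do (`exists_approximation`). With `τ = σ⁵` and `h = σ²` the change is
  `O(σ⁶) = o(τ)`, and every factor `τ A` still gains a factor `σ` (`exists_test_family`).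

The boundary enters only through the defining function `g`: the divergence theorem is replaced by
the inequality `int_div_nonpos` for fields with `F · ∇g ≤ 0` on `{g = 0}`, which follows from
integrating against cutoffs of `g`.
-/

noncomputable section

namespace RKDiffusion

open MeasureTheory Set Filter Topology

variable {d : ℕ}

/-! ### The algebra of smooth functions -/

/-- The smooth functions on `ℝᵈ`, as a subalgebra of all functions. -/
def smoothSubalgebra (d : ℕ) : Subalgebra ℝ (EuclideanSpace ℝ (Fin d) → ℝ) where
  carrier := {f | ContDiff ℝ ∞ f}
  mul_mem' := fun {f h} (hf : ContDiff ℝ ∞ f) (hh : ContDiff ℝ ∞ h) => hf.mul hh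
  add_mem' := fun {f h} (hf : ContDiff ℝ ∞ f) (hh : ContDiff ℝ ∞ h) => hf.add hh
  algebraMap_mem' := fun c => (contDiff_const : ContDiff ℝ ∞ fun _ => c)

/-- The algebra of smooth functions on `ℝᵈ`. Partial derivatives are derivations of it, so that
the differential identities below are identities in a commutative ring. -/
def SmoothFun (d : ℕ) : Type := smoothSubalgebra d

instance (d : ℕ) : CommRing (SmoothFun d) := inferInstanceAs (CommRing (smoothSubalgebra d))
instance (d : ℕ) : Algebra ℝ (SmoothFun d) := inferInstanceAs (Algebra ℝ (smoothSubalgebra d))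

namespace SmoothFun

instance : CoeFun (SmoothFun d) (fun _ => EuclideanSpace ℝ (Fin d) → ℝ) := ⟨fun f => f.1⟩

@[ext] theorem ext {f h : SmoothFun d} (H : ∀ x, f x = h x) : f = h := Subtype.ext (funext H)

/-- A smooth function as an element of the algebra. -/
def mk (f : EuclideanSpace ℝ (Fin d) → ℝ) (hf : ContDiff ℝ ∞ f) : SmoothFun d := ⟨f, hf⟩

@[simp] theorem coe_mk (f : EuclideanSpace ℝ (Fin d) → ℝ) (hf : ContDiff ℝ ∞ f) :
    (mk f hf : EuclideanSpace ℝ (Fin d) → ℝ) = f := rfl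

theorem contDiff (f : SmoothFun d) : ContDiff ℝ ∞ f := f.2

theorem differentiable (f : SmoothFun d) : Differentiable ℝ f :=
  f.contDiff.differentiable (by simp)

theorem continuous (f : SmoothFun d) : Continuous f := f.contDiff.continuous

@[simp] theorem add_apply (f h : SmoothFun d) (x) : (f + h) x = f x + h x := rfl
@[simp] theorem sub_apply (f h : SmoothFun d) (x) : (f - h) x = f x - h x := rfl
@[simp] theorem neg_apply (f : SmoothFun d) (x) : (-f) x = -f x := rfl
@[simp] theorem mul_apply (f h : SmoothFun d) (x) : (f * h) x = f x * h x := rfl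
@[simp] theorem pow_apply (f : SmoothFun d) (n : ℕ) (x) : (f ^ n) x = f x ^ n := rfl
@[simp] theorem smul_apply (c : ℝ) (f : SmoothFun d) (x) : (c • f) x = c * f x := rfl
@[simp] theorem zero_apply (x) : (0 : SmoothFun d) x = 0 := rfl
@[simp] theorem one_apply (x) : (1 : SmoothFun d) x = 1 := rfl
@[simp] theorem sum_apply {ι : Type*} (s : Finset ι) (f : ι → SmoothFun d) (x) :
    (∑ i ∈ s, f i) x = ∑ i ∈ s, f i x := by
  have : (∑ i ∈ s, f i).1 = ∑ i ∈ s, (f i).1 :=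
    map_sum (smoothSubalgebra d).val f s
  rw [this, Finset.sum_apply]

/-- The smooth function `G ∘ f`, for a smooth function `G` of one variable. -/
def comp (G : ℝ → ℝ) (hG : ContDiff ℝ ∞ G) (f : SmoothFun d) : SmoothFun d :=
  ⟨G ∘ f, hG.comp f.contDiff⟩

@[simp] theorem comp_apply (G : ℝ → ℝ) (hG) (f : SmoothFun d) (x) : comp G hG f x = G (f x) := rfl

/-- The partial derivative `∂ᵢ` as a derivation of the algebra of smooth functions. -/
def pderiv (i : Fin d) : Derivation ℝ (SmoothFun d) (SmoothFun d) :=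
  Derivation.mk'
    { toFun := fun f => ⟨fun x => fderiv ℝ f x (EuclideanSpace.single i 1),
        ((f.contDiff.fderiv_right (m := ∞) (by simp)).clm_apply contDiff_const)⟩
      map_add' := fun f h => by
        ext x
        change fderiv ℝ (f.1 + h.1) x _ = _
        rw [fderiv_add (f.differentiable x) (h.differentiable x)]; rfl
      map_smul' := fun c f => by
        ext x
        change fderiv ℝ (c • f.1) x _ = _
        rw [fderiv_const_smul (f.differentiable x)]; rfl }
    (fun f h => by
      ext x
      change fderiv ℝ (f.1 * h.1) x _ = _
      rw [fderiv_mul (f.differentiable x) (h.differentiable x)]; rfl)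

theorem pderiv_apply (i : Fin d) (f : SmoothFun d) (x) :
    pderiv i f x = fderiv ℝ f x (EuclideanSpace.single i 1) := rfl

theorem fderiv_eq_sum (f : SmoothFun d) (x ξ : EuclideanSpace ℝ (Fin d)) :
    fderiv ℝ f x ξ = ∑ i, ξ i * pderiv i f x := by
  conv_lhs => rw [← (EuclideanSpace.basisFun (Fin d) ℝ).sum_repr ξ]
  simp [map_sum, pderiv_apply]

theorem gradient_apply (f : SmoothFun d) (x : EuclideanSpace ℝ (Fin d)) (i : Fin d) :
    gradient f x i = pderiv i f x := by
  rw [pderiv_apply, ← inner_gradient_left, EuclideanSpace.inner_single_right]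
  simp

theorem hasDerivAt_line (f : SmoothFun d) (x ξ : EuclideanSpace ℝ (Fin d)) (t : ℝ) :
    HasDerivAt (fun t : ℝ => f (x + t • ξ)) (∑ i, ξ i * pderiv i f (x + t • ξ)) t := by
  rw [← fderiv_eq_sum]
  have h1 : HasDerivAt (fun t : ℝ => x + t • ξ) ξ t := by
    simpa using ((hasDerivAt_id t).smul_const ξ).const_add x
  exact (f.differentiable _).hasFDerivAt.comp_hasDerivAt t h1

theorem pderiv_comm (i j : Fin d) (f : SmoothFun d) :
    pderiv i (pderiv j f) = pderiv j (pderiv i f) := by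
  ext x
  have key : ∀ i j : Fin d, pderiv i (pderiv j f) x =
      fderiv ℝ (fderiv ℝ f) x (EuclideanSpace.single i 1) (EuclideanSpace.single j 1) := by
    intro i j
    rw [pderiv_apply]
    change fderiv ℝ (fun y => fderiv ℝ f y (EuclideanSpace.single j 1)) x _ = _
    have hd : DifferentiableAt ℝ (fderiv ℝ f) x :=
      (f.contDiff.fderiv_right (m := ∞) (by simp)).differentiable (by simp) x
    rw [fderiv_clm_apply hd (differentiableAt_const _)]
    simp
  rw [key, key]
  have h2 : (2 : WithTop ℕ∞) ≤ ∞ := WithTop.coe_le_coe.2 le_top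
  exact (f.contDiff.contDiffAt.isSymmSndFDerivAt (by simpa using h2)) _ _

theorem pderiv_comp (G G' : ℝ → ℝ) (hG : ContDiff ℝ ∞ G) (hG' : ContDiff ℝ ∞ G')
    (h : ∀ t, HasDerivAt G (G' t) t) (f : SmoothFun d) (i : Fin d) :
    pderiv i (comp G hG f) = comp G' hG' f * pderiv i f := by
  ext x
  rw [pderiv_apply]
  have := ((h (f x)).comp_hasFDerivAt x (f.differentiable x).hasFDerivAt).fderiv
  change fderiv ℝ (G ∘ f.1) x _ = _
  rw [this]; rfl

theorem pderiv_congr {f h : SmoothFun d} {x} (H : f =ᶠ[𝓝 x] h) (i : Fin d) :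
    pderiv i f =ᶠ[𝓝 x] pderiv i h := by
  filter_upwards [H.fderiv (𝕜 := ℝ)] with y hy
  rw [pderiv_apply, pderiv_apply, hy]

/-- The inner product `∇f · ∇h` of two gradients. -/
def dot (f h : SmoothFun d) : SmoothFun d := ∑ i, pderiv i f * pderiv i h

/-- The Laplacian as a linear operator on smooth functions. -/
def lap : SmoothFun d →ₗ[ℝ] SmoothFun d :=
  ∑ i, (pderiv i).toLinearMap ∘ₗ (pderiv i).toLinearMap

theorem lap_def (f : SmoothFun d) : lap f = ∑ i, pderiv i (pderiv i f) := by
  simp [lap]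

theorem dot_apply (f h : SmoothFun d) (x) : dot f h x = ∑ i, pderiv i f x * pderiv i h x := by
  simp [dot]

theorem dot_comm (f h : SmoothFun d) : dot f h = dot h f := by
  simp [dot, mul_comm]

theorem dot_add_left (f₁ f₂ h : SmoothFun d) : dot (f₁ + f₂) h = dot f₁ h + dot f₂ h := by
  simp [dot, add_mul, Finset.sum_add_distrib]

theorem dot_smul_left (c : ℝ) (f h : SmoothFun d) : dot (c • f) h = c • dot f h := by
  simp [dot, Finset.smul_sum]

theorem dot_sub_left (f₁ f₂ h : SmoothFun d) : dot (f₁ - f₂) h = dot f₁ h - dot f₂ h := by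
  simp [dot, sub_mul, Finset.sum_sub_distrib]

theorem dot_mul_left (f₁ f₂ h : SmoothFun d) : dot (f₁ * f₂) h = f₁ * dot f₂ h + f₂ * dot f₁ h := by
  simp only [dot, Derivation.leibniz, smul_eq_mul, Finset.mul_sum, ← Finset.sum_add_distrib]
  exact Finset.sum_congr rfl fun i _ => by ring

theorem lap_mul (f h : SmoothFun d) : lap (f * h) = f * lap h + 2 * dot f h + h * lap f := by
  simp only [lap_def, dot, Derivation.leibniz, smul_eq_mul, map_add, Finset.mul_sum,
    ← Finset.sum_add_distrib]
  exact Finset.sum_congr rfl fun i _ => by ring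

theorem dot_self_nonneg (f : SmoothFun d) (x) : 0 ≤ dot f f x := by
  rw [dot_apply]; exact Finset.sum_nonneg fun i _ => mul_self_nonneg _

theorem inner_gradient (f h : SmoothFun d) (x) :
    inner ℝ (gradient f x) (gradient h x) = dot f h x := by
  rw [dot_apply, PiLp.inner_apply]
  exact Finset.sum_congr rfl fun i _ => by simp [gradient_apply, mul_comm]

theorem norm_gradient_sq (f : SmoothFun d) (x) : ‖gradient f x‖ ^ 2 = dot f f x := by
  rw [← inner_gradient, real_inner_self_eq_norm_sq]

theorem laplacian_eq (f : SmoothFun d) (x) : Laplacian.laplacian (f : _ → ℝ) x = lap f x := by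
  rw [InnerProductSpace.laplacian_eq_iteratedFDeriv_orthonormalBasis f.1
    (EuclideanSpace.basisFun (Fin d) ℝ)]
  simp only [lap_def, sum_apply]
  refine Finset.sum_congr rfl fun i _ => ?_
  rw [iteratedFDeriv_two_apply, pderiv_apply]
  change _ = fderiv ℝ (fun y => fderiv ℝ f y (EuclideanSpace.single i 1)) x _
  have hd : DifferentiableAt ℝ (fderiv ℝ f.1) x :=
    (f.contDiff.fderiv_right (m := ∞) (by simp)).differentiable (by simp) x
  rw [fderiv_clm_apply hd (differentiableAt_const _)]
  simp

theorem dot_congr_left {f h : SmoothFun d} {x} (H : f =ᶠ[𝓝 x] h) (k : SmoothFun d) :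
    dot f k =ᶠ[𝓝 x] dot h k := by
  have := eventually_all.2 fun i => pderiv_congr H i
  filter_upwards [this] with y hy
  simp [dot_apply, hy]

theorem lap_congr {f h : SmoothFun d} {x} (H : f =ᶠ[𝓝 x] h) : lap f =ᶠ[𝓝 x] lap h := by
  have := eventually_all.2 fun i => pderiv_congr (pderiv_congr H i) i
  filter_upwards [this] with y hy
  simp [lap_def, hy]

end SmoothFun

/-! ### Domains with a smooth defining function -/

/-- A bounded domain `{g < 0}` with a smooth defining function `g`. -/
structure SmoothDomain (d : ℕ) where
  /-- The defining function. -/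
  g : SmoothFun d
  bounded : Bornology.IsBounded {x | g x < 0}
  dot_self_ne_zero : ∀ x, g x = 0 → SmoothFun.dot g g x ≠ 0

namespace SmoothDomain
open SmoothFun
variable (D : SmoothDomain d)

/-- The open set `{g < 0}`. -/
def inside : Set (EuclideanSpace ℝ (Fin d)) := {x | D.g x < 0}

theorem mem_inside {x} : x ∈ D.inside ↔ D.g x < 0 := Iff.rfl

theorem inside_subset : D.inside ⊆ {x | D.g x ≤ 0} := fun x hx =>
  show D.g x ≤ 0 from (D.mem_inside.1 hx).le

theorem isOpen_inside : IsOpen D.inside := isOpen_lt D.g.continuous continuous_const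

theorem measurableSet_inside : MeasurableSet D.inside := D.isOpen_inside.measurableSet

theorem hasDerivAt_inward (x) :
    HasDerivAt (fun t : ℝ => D.g (x + t • -gradient D.g x)) (-(dot D.g D.g x)) 0 := by
  convert D.g.hasDerivAt_line x (-gradient D.g x) 0 using 1
  simp [dot_apply, gradient_apply]

theorem closure_inside : closure D.inside = {x | D.g x ≤ 0} := by
  apply Subset.antisymm
  · exact closure_minimal D.inside_subset (isClosed_le D.g.continuous continuous_const)
  · intro x hx
    rcases lt_or_eq_of_le (show D.g x ≤ 0 from hx) with h | h
    · exact subset_closure h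
    · have hn := D.hasDerivAt_inward x
      set n := -gradient D.g x
      have hneg : -(dot D.g D.g x) < 0 := by
        have := lt_of_le_of_ne (dot_self_nonneg D.g x) (D.dot_self_ne_zero x h).symm
        linarith
      have hlim : Tendsto (fun t : ℝ => x + t • n) (𝓝[>] 0) (𝓝 x) := by
        have : Continuous (fun t : ℝ => x + t • n) := by fun_prop
        simpa using (this.tendsto 0).mono_left nhdsWithin_le_nhds
      refine mem_closure_of_tendsto hlim ?_
      have := (hasDerivAt_iff_tendsto_slope.1 hn).mono_left
        (nhdsWithin_mono _ (fun y (hy : (0:ℝ) < y) => ne_of_gt hy))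
      filter_upwards [this.eventually (gt_mem_nhds hneg), self_mem_nhdsWithin] with t ht ht0
      rw [slope_def_field] at ht
      simp only [zero_smul, add_zero, h, sub_zero] at ht
      have ht0 : 0 < t := ht0
      rw [div_lt_iff₀ ht0] at ht
      change D.g _ < 0
      linarith

theorem frontier_inside : frontier D.inside = {x | D.g x = 0} := by
  rw [frontier, D.closure_inside, D.isOpen_inside.interior_eq]
  ext x
  rw [Set.mem_sdiff, mem_inside, not_lt]
  exact ⟨fun h => le_antisymm h.1 h.2, fun h => ⟨le_of_eq h, ge_of_eq h⟩⟩

theorem isCompact_closed : IsCompact {x | D.g x ≤ 0} := by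
  rw [← D.closure_inside]
  exact D.bounded.isCompact_closure

theorem isCompact_boundary : IsCompact {x | D.g x = 0} :=
  D.isCompact_closed.of_isClosed_subset (isClosed_eq D.g.continuous continuous_const)
    (fun _ h => le_of_eq h)

theorem exists_bound (f : SmoothFun d) : ∃ C, 0 < C ∧ ∀ x, D.g x ≤ 0 → |f x| ≤ C := by
  obtain ⟨C, hC⟩ := D.isCompact_closed.exists_bound_of_continuousOn f.continuous.continuousOn
  exact ⟨max C 1, by positivity, fun x hx => (hC x hx).trans (le_max_left _ _)⟩

theorem integrableOn {f : EuclideanSpace ℝ (Fin d) → ℝ} (hf : Continuous f) :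
    IntegrableOn f D.inside :=
  (hf.continuousOn.integrableOn_compact D.isCompact_closed).mono_set D.inside_subset

/-- The integral over the domain, as a linear functional on smooth functions. -/
def int : SmoothFun d →ₗ[ℝ] ℝ where
  toFun f := ∫ x in D.inside, f x
  map_add' f h := integral_add (D.integrableOn f.continuous) (D.integrableOn h.continuous)
  map_smul' c _ := integral_const_mul c _

theorem int_apply (f : SmoothFun d) : D.int f = ∫ x in D.inside, f x := rfl

theorem int_mono {f h : SmoothFun d} (H : ∀ x, D.g x < 0 → f x ≤ h x) : D.int f ≤ D.int h :=
  setIntegral_mono_on (D.integrableOn f.continuous) (D.integrableOn h.continuous)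
    D.measurableSet_inside H

theorem int_congr {f h : SmoothFun d} (H : ∀ x, D.g x < 0 → f x = h x) : D.int f = D.int h :=
  setIntegral_congr_fun D.measurableSet_inside H

theorem int_nonneg {f : SmoothFun d} (H : ∀ x, D.g x < 0 → 0 ≤ f x) : 0 ≤ D.int f := by
  simpa using D.int_mono (f := 0) (h := f) H

theorem eq_zero_of_int_eq_zero {f : SmoothFun d} (H : ∀ x, D.g x < 0 → 0 ≤ f x)
    (h0 : D.int f = 0) : ∀ x, D.g x < 0 → f x = 0 := by
  have h1 := (setIntegral_eq_zero_iff_of_nonneg_ae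
    ((ae_restrict_iff' D.measurableSet_inside).2 (Eventually.of_forall H))
    (D.integrableOn f.continuous)).1 h0
  have := Measure.eqOn_open_of_ae_eq h1 D.isOpen_inside f.continuous.continuousOn continuousOn_const
  exact fun x hx => this hx

/-- A function which is nonpositive on the boundary grows at most linearly in `-g`. For large `M` no
interior maximum of `f + M g` is positive: `∇f = -M ∇g` there, so that `∇g` is small, hence `g` is
far below `0`. -/
theorem exists_le_neg_mul {f : SmoothFun d} (hf : ∀ x, D.g x = 0 → f x ≤ 0) :
    ∃ M, 0 ≤ M ∧ ∀ x, D.g x ≤ 0 → f x ≤ -(M * D.g x) := by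
  by_cases hne : ({x | D.g x ≤ 0}).Nonempty
  swap
  · exact ⟨0, le_rfl, fun x hx => absurd ⟨x, hx⟩ hne⟩
  obtain ⟨y, hy, hmin⟩ := D.isCompact_closed.exists_isMinOn hne
    (f := (dot D.g D.g - D.g : SmoothFun d)) (SmoothFun.continuous _).continuousOn
  set c := (dot D.g D.g - D.g : SmoothFun d) y with hc
  have hcpos : 0 < c := by
    rw [hc, sub_apply]
    rcases lt_or_eq_of_le (show D.g y ≤ 0 from hy) with h | h
    · linarith [dot_self_nonneg D.g y]
    · have := lt_of_le_of_ne (dot_self_nonneg D.g y) (D.dot_self_ne_zero y h).symm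
      linarith
  obtain ⟨S, hS, hfS⟩ := D.exists_bound f
  obtain ⟨L, hL, hfL⟩ := D.exists_bound (dot f f)
  set M := 2 * S / c + 2 * L / c + 1 with hM
  have hMpos : 1 ≤ M := by
    have : 0 ≤ 2 * S / c + 2 * L / c := by positivity
    linarith
  refine ⟨M, by linarith, ?_⟩
  -- the maximum of `f + M g` is attained on the boundary, or at a point where `∇f = -M ∇g`
  obtain ⟨z, hz, hmax⟩ := D.isCompact_closed.exists_isMaxOn hne
    (f := (f + M • D.g : SmoothFun d)) (SmoothFun.continuous _).continuousOn
  suffices h : (f + M • D.g : SmoothFun d) z ≤ 0 by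
    intro x hx
    have := hmax hx
    simp only [mem_ofPred_eq] at this
    have h3 := this.trans h
    simp only [add_apply, smul_apply] at h3
    linarith
  rcases lt_or_eq_of_le (show D.g z ≤ 0 from hz) with h | h
  swap
  · simp [h, hf z h]
  have hloc : IsLocalMax (f + M • D.g : SmoothFun d) z :=
    hmax.isLocalMax (Filter.mem_of_superset (D.isOpen_inside.mem_nhds h) D.inside_subset)
  have hder : ∀ i, pderiv i f z = -(M * pderiv i D.g z) := by
    intro i
    have h1 : pderiv i (f + M • D.g) z = 0 := by
      rw [pderiv_apply, hloc.fderiv_eq_zero]; rfl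
    simp only [map_add, Derivation.map_smul, add_apply, smul_apply] at h1
    linarith
  have hdd : dot f f z = M ^ 2 * dot D.g D.g z := by
    simp only [dot_apply, hder, Finset.mul_sum]
    exact Finset.sum_congr rfl fun i _ => by ring
  have h4 : M * dot D.g D.g z ≤ L := by
    have h5 := (le_abs_self _).trans (hfL z hz)
    have h6 := dot_self_nonneg D.g z
    rw [hdd] at h5
    nlinarith
  have h7 : c ≤ dot D.g D.g z - D.g z := hmin hz
  have h8 : f z ≤ S := (le_abs_self _).trans (hfS z hz)
  have h9 : M * c = 2 * S + 2 * L + c := by rw [hM]; field_simp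
  simp only [add_apply, smul_apply]
  nlinarith

end SmoothDomain

theorem integral_pderiv_eq_zero (f : SmoothFun d) (hf : HasCompactSupport f) (i : Fin d) :
    ∫ x, SmoothFun.pderiv i f x = 0 := by
  have hc : HasCompactSupport (SmoothFun.pderiv i f) := by
    refine (hf.fderiv (𝕜 := ℝ)).mono fun x hx h => hx ?_
    rw [SmoothFun.pderiv_apply, h]; rfl
  have hi : Integrable (SmoothFun.pderiv i f) volume :=
    (SmoothFun.continuous (SmoothFun.pderiv i f)).integrable_of_hasCompactSupport hc
  have hi' : Integrable f volume := f.continuous.integrable_of_hasCompactSupport hf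
  have := integral_mul_fderiv_eq_neg_fderiv_mul_of_integrable (𝕜 := ℝ) (μ := volume)
    (f := fun _ : EuclideanSpace ℝ (Fin d) => (1 : ℝ)) (g := f) (v := EuclideanSpace.single i 1)
    (by simp)
    (by simp only [one_mul]; exact hi)
    (by simp only [one_mul]; exact hi')
    (by fun_prop) (fun x _ => f.differentiable x)
  simpa [SmoothFun.pderiv_apply] using this

/-! ### The divergence inequality -/

theorem contDiff_deriv_smoothTransition : ContDiff ℝ ∞ (deriv Real.smoothTransition) :=
  ((contDiff_succ_iff_deriv (n := ∞)).1 (Real.smoothTransition.contDiff (n := ⊤))).2.2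

theorem deriv_smoothTransition_eq_zero {t : ℝ} (ht : t ≤ 0 ∨ 1 ≤ t) :
    deriv Real.smoothTransition t = 0 := by
  rcases ht with h | h
  · have : IsLocalMin Real.smoothTransition t := by
      refine Eventually.of_forall fun s => ?_
      rw [Real.smoothTransition.zero_of_nonpos h]
      exact Real.smoothTransition.nonneg s
    exact this.deriv_eq_zero
  · have : IsLocalMax Real.smoothTransition t := by
      refine Eventually.of_forall fun s => ?_
      rw [Real.smoothTransition.one_of_one_le h]
      exact Real.smoothTransition.le_one s
    exact this.deriv_eq_zero

theorem deriv_smoothTransition_nonneg (t : ℝ) : 0 ≤ deriv Real.smoothTransition t :=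
  Real.smoothTransition.monotone.deriv_nonneg

theorem exists_deriv_smoothTransition_le : ∃ C, 0 ≤ C ∧ ∀ t, deriv Real.smoothTransition t ≤ C := by
  obtain ⟨C, hC⟩ := (isCompact_Icc (a := (0:ℝ)) (b := 1)).exists_bound_of_continuousOn
    contDiff_deriv_smoothTransition.continuous.continuousOn
  refine ⟨max C 0, le_max_right _ _, fun t => ?_⟩
  by_cases ht : t ∈ Icc (0:ℝ) 1
  · exact (le_abs_self _).trans ((hC t ht).trans (le_max_left _ _))
  · rw [deriv_smoothTransition_eq_zero]
    · exact le_max_right _ _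
    · rw [mem_Icc, not_and_or, not_le, not_le] at ht
      exact ht.imp le_of_lt le_of_lt

namespace SmoothDomain
open SmoothFun
variable (D : SmoothDomain d)

/-- The interior cutoff, which vanishes where `g ≥ -1/N` and equals `1` where `g ≤ -2/N`. -/
def cutoff (N : ℝ) : SmoothFun d :=
  comp (fun t => Real.smoothTransition (-(N * t) - 1))
    (Real.smoothTransition.contDiff.comp (by fun_prop)) D.g

theorem pderiv_cutoff (N : ℝ) (i : Fin d) (x) : pderiv i (D.cutoff N) x =
    -(N * deriv Real.smoothTransition (-(N * D.g x) - 1)) * pderiv i D.g x := by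
  rw [cutoff, pderiv_comp _ (fun t => -(N * deriv Real.smoothTransition (-(N * t) - 1)))]
  · rfl
  · exact (contDiff_const.mul (contDiff_deriv_smoothTransition.comp (by fun_prop))).neg
  · intro t
    have h1 : HasDerivAt (fun t => -(N * t) - 1) (-N) t := by
      simpa using (((hasDerivAt_id t).const_mul N).neg).sub_const 1
    have h2 : HasDerivAt Real.smoothTransition
        (deriv Real.smoothTransition (-(N * t) - 1)) (-(N * t) - 1) :=
      (Real.smoothTransition.contDiff.differentiable (n := 1) (by simp) _).hasDerivAt
    exact (h2.comp t h1).congr_deriv (mul_neg _ _ |>.trans (by rw [mul_comm]))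

theorem cutoff_apply (N : ℝ) (x) :
    D.cutoff N x = Real.smoothTransition (-(N * D.g x) - 1) := rfl

theorem abs_cutoff_le (N : ℝ) (x) : |D.cutoff N x| ≤ 1 := by
  rw [cutoff_apply, abs_of_nonneg (Real.smoothTransition.nonneg _)]
  exact Real.smoothTransition.le_one _

theorem eventually_two_le {x} (hx : D.g x < 0) :
    ∀ᶠ n : ℕ in atTop, 2 ≤ -((n : ℝ) * D.g x) := by
  filter_upwards [(tendsto_natCast_atTop_atTop (R := ℝ)).eventually_ge_atTop (2 / -D.g x)] with n hn
  rw [div_le_iff₀ (by linarith)] at hn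
  linarith

theorem tendsto_int_cutoff_mul (f : SmoothFun d) :
    Tendsto (fun n : ℕ => D.int (D.cutoff n * f)) atTop (𝓝 (D.int f)) := by
  refine tendsto_integral_of_dominated_convergence (fun x => |f x|)
    (fun n => (SmoothFun.continuous _).aestronglyMeasurable)
    (D.integrableOn f.continuous.abs) (fun n => Eventually.of_forall fun x => ?_)
    ((ae_restrict_iff' D.measurableSet_inside).2 (Eventually.of_forall fun x hx => ?_))
  · rw [mul_apply, norm_mul, Real.norm_eq_abs, Real.norm_eq_abs]
    exact mul_le_of_le_one_left (abs_nonneg _) (D.abs_cutoff_le _ _)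
  · refine tendsto_const_nhds.congr' ?_
    filter_upwards [D.eventually_two_le hx] with n hn
    rw [mul_apply, cutoff_apply, Real.smoothTransition.one_of_one_le (by linarith), one_mul]

/-- A vector field which points inwards (or is tangential) on the boundary has a nonpositive total
divergence. Multiply by the cutoff and integrate by parts: as `F · ∇g ≤ M |g|`, the integrand
`N S'(-N g - 1) F · ∇g` is bounded, and it lives in a boundary layer that shrinks to the empty
set. -/
theorem int_div_nonpos (F : Fin d → SmoothFun d)
    (hF : ∀ x, D.g x = 0 → ∑ i, F i x * pderiv i D.g x ≤ 0) :
    D.int (∑ i, pderiv i (F i)) ≤ 0 := by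
  obtain ⟨M, hM, hle⟩ := D.exists_le_neg_mul (f := ∑ i, F i * pderiv i D.g)
    (by simpa using hF)
  obtain ⟨C, hC0, hC⟩ := exists_deriv_smoothTransition_le
  set P : ℝ → ℝ := fun s => deriv Real.smoothTransition (s - 1) * s with hP
  have hPcont : Continuous P :=
    (contDiff_deriv_smoothTransition.continuous.comp (by fun_prop)).mul continuous_id
  have hPzero : ∀ s, s ≤ 1 ∨ 2 ≤ s → P s = 0 := by
    intro s hs
    simp only [hP]
    rw [deriv_smoothTransition_eq_zero (hs.imp (by intro h; linarith) (by intro h; linarith)),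
      zero_mul]
  have hPbound : ∀ s, |P s| ≤ C * 2 := by
    intro s
    by_cases hs : s ≤ 1 ∨ 2 ≤ s
    · rw [hPzero s hs, abs_zero]; positivity
    · push Not at hs
      simp only [hP]
      rw [abs_mul, abs_of_nonneg (deriv_smoothTransition_nonneg _), abs_of_pos (by linarith)]
      exact mul_le_mul (hC _) hs.2.le (by linarith) hC0
  have key : ∀ n : ℕ, D.int (D.cutoff n * ∑ i, pderiv i (F i)) ≤
      ∫ x in D.inside, M * P (-(n * D.g x)) := by
    intro n
    have hzero : ∫ x, (∑ i, pderiv i (D.cutoff n * F i)) x = 0 := by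
      have hs : ∀ i, HasCompactSupport (D.cutoff n * F i : SmoothFun d) := fun i =>
        HasCompactSupport.intro D.isCompact_closed fun x hx => by
          have hx : 0 < D.g x := not_le.1 hx
          have : 0 ≤ n * D.g x := by positivity
          rw [mul_apply, cutoff_apply, Real.smoothTransition.zero_of_nonpos (by linarith), zero_mul]
      simp only [sum_apply]
      rw [integral_finsetSum]
      · exact Finset.sum_eq_zero fun i _ => integral_pderiv_eq_zero _ (hs i) i
      · intro i _
        refine (SmoothFun.continuous _).integrable_of_hasCompactSupport ?_
        refine ((hs i).fderiv (𝕜 := ℝ)).mono fun x hx h => hx ?_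
        rw [SmoothFun.pderiv_apply, h]; rfl
    have hexp : ∀ x, (∑ i, pderiv i (D.cutoff n * F i)) x =
        (D.cutoff n * ∑ i, pderiv i (F i)) x -
          n * deriv Real.smoothTransition (-(n * D.g x) - 1) *
            (∑ i, F i * pderiv i D.g) x := by
      intro x
      simp only [sum_apply, Derivation.leibniz, smul_eq_mul, add_apply, mul_apply, pderiv_cutoff,
        Finset.mul_sum, ← Finset.sum_sub_distrib]
      exact Finset.sum_congr rfl fun i _ => by ring
    have hin : ∫ x in D.inside, (∑ i, pderiv i (D.cutoff n * F i)) x = 0 := by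
      rw [setIntegral_eq_integral_of_forall_compl_eq_zero, hzero]
      intro x hx
      have hx : 0 ≤ D.g x := not_lt.1 hx
      have : 0 ≤ n * D.g x := by positivity
      rw [hexp, mul_apply, cutoff_apply, Real.smoothTransition.zero_of_nonpos (by linarith),
        deriv_smoothTransition_eq_zero (Or.inl (by linarith))]
      ring
    have hc : Continuous fun x => n * deriv Real.smoothTransition (-(n * D.g x) - 1) *
        (∑ i, F i * pderiv i D.g) x := by
      have h1 := D.g.continuous
      exact (continuous_const.mul (contDiff_deriv_smoothTransition.continuous.comp
        (by fun_prop))).mul (SmoothFun.continuous _)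
    simp only [hexp] at hin
    rw [integral_sub (D.integrableOn (SmoothFun.continuous _)) (D.integrableOn hc)] at hin
    rw [int_apply]
    rw [sub_eq_zero.1 hin]
    refine setIntegral_mono_on (D.integrableOn hc) (D.integrableOn ?_) D.measurableSet_inside ?_
    · have h1 := D.g.continuous
      exact continuous_const.mul (hPcont.comp (by fun_prop))
    · intro x hx
      have h1 := hle x (le_of_lt hx)
      have h2 := deriv_smoothTransition_nonneg (-(n * D.g x) - 1)
      have h3 : 0 ≤ n * deriv Real.smoothTransition (-(n * D.g x) - 1) := by positivity
      refine (mul_le_mul_of_nonneg_left h1 h3).trans (le_of_eq ?_)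
      simp only [hP]
      ring
  have hlim : Tendsto (fun n : ℕ => ∫ x in D.inside, M * P (-(n * D.g x))) atTop (𝓝 0) := by
    have h0 : (0:ℝ) = ∫ x in D.inside, (0:ℝ) := by simp
    rw [h0]
    refine tendsto_integral_of_dominated_convergence (fun x => M * (C * 2)) (fun n => ?_)
      (D.integrableOn continuous_const) (fun n => Eventually.of_forall fun x => ?_)
      ((ae_restrict_iff' D.measurableSet_inside).2 (Eventually.of_forall fun x hx => ?_))
    · have h1 := D.g.continuous
      exact (continuous_const.mul (hPcont.comp (by fun_prop))).aestronglyMeasurable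
    · rw [norm_mul, Real.norm_eq_abs, Real.norm_eq_abs, abs_of_nonneg hM]
      exact mul_le_mul_of_nonneg_left (hPbound _) hM
    · refine tendsto_const_nhds.congr' ?_
      filter_upwards [D.eventually_two_le hx] with n hn
      rw [hPzero _ (Or.inr hn), mul_zero]
  exact le_of_tendsto_of_tendsto' (D.tendsto_int_cutoff_mul _) hlim key

/-- The homogeneous Neumann condition on the boundary `{g = 0}`. -/
def Neumann (f : SmoothFun d) : Prop := ∀ x, D.g x = 0 → dot f D.g x = 0

/-- Green's first identity. -/
theorem int_mul_lap (f : SmoothFun d) {h : SmoothFun d} (hh : D.Neumann h) :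
    D.int (f * lap h) = -D.int (dot f h) := by
  have hdiv : ∑ i, pderiv i (f * pderiv i h) = f * lap h + dot f h := by
    simp only [lap_def, dot, Derivation.leibniz, smul_eq_mul, Finset.mul_sum,
      ← Finset.sum_add_distrib]
    exact Finset.sum_congr rfl fun i _ => by ring
  have hsum : ∀ x, ∑ i, (f * pderiv i h) x * pderiv i D.g x = f x * dot h D.g x := by
    intro x
    simp only [mul_apply, dot_apply, Finset.mul_sum, mul_assoc]
  have h1 := D.int_div_nonpos (fun i => f * pderiv i h)
    (fun x hx => by rw [hsum, hh x hx, mul_zero])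
  have h2 := D.int_div_nonpos (fun i => -(f * pderiv i h))
    (fun x hx => by simp only [neg_apply, neg_mul, Finset.sum_neg_distrib, hsum, hh x hx]; simp)
  simp only [map_neg, Finset.sum_neg_distrib, hdiv, map_add] at h1 h2
  linarith

theorem int_mul_lap_symm {f h : SmoothFun d} (hf : D.Neumann f) (hh : D.Neumann h) :
    D.int (f * lap h) = D.int (lap f * h) := by
  rw [D.int_mul_lap f hh, mul_comm, D.int_mul_lap h hf, dot_comm]

/-! ### Convexity of the boundary and Bochner's formula -/

/-- The second fundamental form of the boundary of a convex domain is nonnegative. -/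
theorem hessian_nonneg_of_tangent (hconv : Convex ℝ D.inside)
    {x : EuclideanSpace ℝ (Fin d)} (hx : D.g x = 0) (ξ : EuclideanSpace ℝ (Fin d))
    (hξ : ∑ i, ξ i * pderiv i D.g x = 0) :
    0 ≤ ∑ i, ξ i * ∑ j, ξ j * pderiv i (pderiv j D.g) x := by
  have hpos : 0 < dot D.g D.g x :=
    lt_of_le_of_ne (dot_self_nonneg D.g x) (D.dot_self_ne_zero x hx).symm
  -- the tangent line does not meet the domain
  have hout : ∀ t : ℝ, 0 ≤ D.g (x + t • ξ) := by
    intro t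
    by_contra hneg
    push Not at hneg
    have hc : Continuous fun δ : ℝ => D.g (x + t • ξ + δ • gradient D.g x) := by
      have := D.g.continuous
      fun_prop
    have h1 : ∀ᶠ δ : ℝ in 𝓝[>] 0, D.g (x + t • ξ + δ • gradient D.g x) < 0 :=
      ((hc.tendsto 0).eventually (gt_mem_nhds (by simpa using hneg))).filter_mono
        nhdsWithin_le_nhds
    obtain ⟨δ, hδ, hδ0⟩ := (h1.and self_mem_nhdsWithin).exists
    have hδ0 : 0 < δ := hδ0
    set n := t • ξ + δ • gradient D.g x with hn
    have hder := D.g.hasDerivAt_line x n 0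
    have hval : ∑ i, n i * pderiv i D.g (x + (0:ℝ) • n) = δ * dot D.g D.g x := by
      simp only [hn, zero_smul, add_zero, PiLp.add_apply, PiLp.smul_apply, smul_eq_mul, add_mul,
        Finset.sum_add_distrib, gradient_apply, dot_apply, mul_assoc, ← Finset.mul_sum, hξ]
      ring
    rw [hval] at hder
    have hslope := (hasDerivAt_iff_tendsto_slope.1 hder).mono_left
      (nhdsWithin_mono _ (show Ioi (0:ℝ) ⊆ {0}ᶜ from fun y (hy : (0:ℝ) < y) => ne_of_gt hy))
    obtain ⟨s, hs, hs0, hs1⟩ := ((hslope.eventually (lt_mem_nhds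
      (show 0 < δ * dot D.g D.g x by positivity))).and (Ioo_mem_nhdsGT (zero_lt_one' ℝ))).exists
    rw [slope_def_field] at hs
    simp only [zero_smul, add_zero, hx, sub_zero] at hs
    have hgpos : 0 < D.g (x + s • n) := by
      by_contra hcon
      push Not at hcon
      exact absurd hs (not_lt.2 (div_nonpos_of_nonpos_of_nonneg hcon hs0.le))
    have hmem : (1 - s) • x + s • (x + t • ξ + δ • gradient D.g x) ∈ interior D.inside := by
      refine hconv.combo_closure_interior_mem_interior ?_ ?_ (by linarith) hs0 (by ring)
      · rw [D.closure_inside]; exact hx.le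
      · rw [D.isOpen_inside.interior_eq]; exact hδ
    have heq : (1 - s) • x + s • (x + t • ξ + δ • gradient D.g x) = x + s • n := by
      rw [hn]; module
    rw [heq, D.isOpen_inside.interior_eq, mem_inside] at hmem
    linarith
  -- so `0` minimises `t ↦ g (x + t ξ)`
  have hd1 : deriv (fun t : ℝ => D.g (x + t • ξ)) =
      fun t => (∑ i, ξ i • pderiv i D.g : SmoothFun d) (x + t • ξ) := by
    funext t
    rw [(D.g.hasDerivAt_line x ξ t).deriv]
    simp
  have hd2 : deriv (deriv (fun t : ℝ => D.g (x + t • ξ))) 0 =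
      ∑ i, ξ i * ∑ j, ξ j * pderiv i (pderiv j D.g) x := by
    rw [hd1, ((∑ i, ξ i • pderiv i D.g : SmoothFun d).hasDerivAt_line x ξ 0).deriv]
    simp
  by_contra hneg
  push Not at hneg
  rw [← hd2] at hneg
  have hmax := isLocalMax_of_deriv_deriv_neg hneg
    (by rw [hd1]; simpa using hξ) ((D.g.hasDerivAt_line x ξ 0).continuousAt)
  have hev : (fun t : ℝ => D.g (x + t • ξ)) =ᶠ[𝓝 0] fun _ => 0 := by
    filter_upwards [hmax] with t ht
    exact le_antisymm (by simpa [hx] using ht) (hout t)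
  have := hev.deriv.deriv_eq
  simp only [deriv_const'] at this
  rw [this] at hneg
  simp at hneg

/-- A function that vanishes on the boundary has a gradient normal to the boundary. -/
theorem tangent_deriv_eq_zero {q : SmoothFun d} (hq : ∀ x, D.g x = 0 → q x = 0)
    {x : EuclideanSpace ℝ (Fin d)} (hx : D.g x = 0) (ξ : EuclideanSpace ℝ (Fin d))
    (hξ : ∑ i, ξ i * pderiv i D.g x = 0) : ∑ i, ξ i * pderiv i q x = 0 := by
  have hext : IsLocalExtrOn (q : _ → ℝ) {y | D.g y = D.g x} x := by
    refine Or.inl (eventually_nhdsWithin_of_forall fun y hy => ?_)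
    rw [hq x hx, hq y ((show D.g y = D.g x from hy).trans hx)]
  have hstrict : ∀ f : SmoothFun d, HasStrictFDerivAt (f : _ → ℝ) (fderiv ℝ f x) x := fun f =>
    f.contDiff.contDiffAt.hasStrictFDerivAt (by simp)
  obtain ⟨a, b, hab, h⟩ :=
    hext.exists_multipliers_of_hasStrictFDerivAt_1d (hstrict D.g) (hstrict q)
  have hb : b ≠ 0 := by
    rintro rfl
    have ha : a ≠ 0 := by
      rintro rfl; exact hab rfl
    have h0 : fderiv ℝ D.g x = 0 := by simpa [ha] using h
    apply D.dot_self_ne_zero x hx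
    rw [dot_apply]
    exact Finset.sum_eq_zero fun i _ => by rw [pderiv_apply, h0]; simp
  have h2 := congrArg (fun l => l ξ) h
  simp only [_root_.add_apply, _root_.smul_apply, fderiv_eq_sum, hξ,
    smul_eq_mul, mul_zero, zero_add, _root_.zero_apply] at h2
  exact (mul_eq_zero.1 h2).resolve_left hb

/-- On a convex domain, `|∇φ|²` does not increase outwards across the boundary if `φ` satisfies
the Neumann condition. -/
theorem dot_dot_self_nonpos (hconv : Convex ℝ D.inside) {φ : SmoothFun d} (hφ : D.Neumann φ)
    {x : EuclideanSpace ℝ (Fin d)} (hx : D.g x = 0) : dot (dot φ φ) D.g x ≤ 0 := by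
  set ξ := gradient φ x with hξdef
  have hξi : ∀ i, ξ i = pderiv i φ x := gradient_apply φ x
  have hξ : ∑ i, ξ i * pderiv i D.g x = 0 := by
    simpa only [hξi, dot_apply] using hφ x hx
  have h1 := D.hessian_nonneg_of_tangent hconv hx ξ hξ
  have h2 := D.tangent_deriv_eq_zero (q := dot φ D.g) hφ hx ξ hξ
  have h3 : ∀ i, pderiv i (dot φ D.g) x =
      ∑ j, (pderiv i (pderiv j φ) x * pderiv j D.g x + ξ j * pderiv i (pderiv j D.g) x) := by
    intro i
    simp only [dot, map_sum, sum_apply, Derivation.leibniz, smul_eq_mul, add_apply, mul_apply, hξi]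
    exact Finset.sum_congr rfl fun j _ => by ring
  have h4 : dot (dot φ φ) D.g x = 2 * ∑ i, ξ i * ∑ j, pderiv i (pderiv j φ) x * pderiv j D.g x := by
    have : ∀ j, pderiv j (dot φ φ) x = 2 * ∑ i, ξ i * pderiv i (pderiv j φ) x := by
      intro j
      simp only [dot, map_sum, sum_apply, Derivation.leibniz, smul_eq_mul, add_apply, mul_apply,
        hξi, Finset.mul_sum]
      exact Finset.sum_congr rfl fun i _ => by rw [pderiv_comm]; ring
    rw [dot_apply]
    simp only [this, Finset.mul_sum, Finset.sum_mul]
    rw [Finset.sum_comm]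
    exact Finset.sum_congr rfl fun i _ => Finset.sum_congr rfl fun j _ => by ring
  simp only [h3, Finset.sum_add_distrib, mul_add] at h2
  rw [h4]
  linarith

end SmoothDomain

namespace SmoothFun

/-- The squared Frobenius norm of the Hessian. -/
def hessSq (φ : SmoothFun d) : SmoothFun d := ∑ i, ∑ j, pderiv i (pderiv j φ) ^ 2

theorem hessSq_nonneg (φ : SmoothFun d) (x) : 0 ≤ hessSq φ x := by
  simp only [hessSq, sum_apply, pow_apply]
  exact Finset.sum_nonneg fun i _ => Finset.sum_nonneg fun j _ => sq_nonneg _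

theorem lap_eq_zero_of_hessSq {φ : SmoothFun d} {x} (h : hessSq φ x = 0) : lap φ x = 0 := by
  simp only [hessSq, sum_apply, pow_apply] at h
  rw [lap_def, sum_apply]
  refine Finset.sum_eq_zero fun i _ => ?_
  have h1 := (Finset.sum_eq_zero_iff_of_nonneg
    fun i _ => Finset.sum_nonneg fun j _ => sq_nonneg _).1 h i (Finset.mem_univ i)
  have h2 := (Finset.sum_eq_zero_iff_of_nonneg fun j _ => sq_nonneg _).1 h1 i (Finset.mem_univ i)
  exact pow_eq_zero_iff (two_ne_zero) |>.1 h2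

/-- Bochner's formula. -/
theorem lap_dot_self (φ : SmoothFun d) :
    lap (dot φ φ) = 2 * hessSq φ + 2 * dot φ (lap φ) := by
  have h1 : ∀ i, pderiv i (pderiv i (dot φ φ)) =
      ∑ j, (2 * pderiv i (pderiv j φ) ^ 2 +
        2 * (pderiv j φ * pderiv j (pderiv i (pderiv i φ)))) := by
    intro i
    simp only [dot, map_sum, Derivation.leibniz, smul_eq_mul, map_add]
    refine Finset.sum_congr rfl fun j _ => ?_
    rw [pderiv_comm j i (pderiv i φ), pderiv_comm j i φ]
    ring
  rw [lap_def]
  simp only [h1, Finset.sum_add_distrib, ← Finset.mul_sum]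
  congr 2
  rw [Finset.sum_comm, dot]
  simp only [lap_def, map_sum, Finset.mul_sum]

/-- The exponential of a smooth function. -/
def exp (φ : SmoothFun d) : SmoothFun d := comp Real.exp Real.contDiff_exp φ

@[simp] theorem exp_apply (φ : SmoothFun d) (x) : exp φ x = Real.exp (φ x) := rfl

theorem pderiv_exp (φ : SmoothFun d) (i : Fin d) : pderiv i (exp φ) = exp φ * pderiv i φ :=
  pderiv_comp _ _ _ Real.contDiff_exp Real.hasDerivAt_exp φ i

theorem dot_exp (φ h : SmoothFun d) : dot (exp φ) h = exp φ * dot φ h := by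
  simp only [dot, pderiv_exp, Finset.mul_sum, mul_assoc]

theorem lap_exp (φ : SmoothFun d) : lap (exp φ) = exp φ * (lap φ + dot φ φ) := by
  simp only [lap_def, pderiv_exp, Derivation.leibniz, smul_eq_mul, dot, Finset.mul_sum,
    ← Finset.sum_add_distrib]
  exact Finset.sum_congr rfl fun i _ => by ring

end SmoothFun

namespace SmoothDomain
open SmoothFun
variable (D : SmoothDomain d)

theorem Neumann.exp {φ : SmoothFun d} (hφ : D.Neumann φ) : D.Neumann (exp φ) := fun x hx => by
  rw [dot_exp, mul_apply, hφ x hx, mul_zero]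

/-- The Bakry-Émery estimate for the second derivative of the entropy along the heat flow. -/
theorem two_mul_int_exp_mul_hessSq_le (hconv : Convex ℝ D.inside) {φ : SmoothFun d}
    (hφ : D.Neumann φ) :
    2 * D.int (exp φ * hessSq φ) ≤ D.int (lap (exp φ) * (2 * lap φ + dot φ φ)) := by
  have hU := hφ.exp
  have h1 := D.int_div_nonpos (fun i => exp φ * pderiv i (dot φ φ)) (fun x hx => by
    have := D.dot_dot_self_nonpos hconv hφ hx
    rw [dot_apply] at this
    simp only [mul_apply, mul_assoc, ← Finset.mul_sum, exp_apply]
    exact mul_nonpos_of_nonneg_of_nonpos (Real.exp_pos _).le this)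
  have hdiv : ∑ i, pderiv i (exp φ * pderiv i (dot φ φ)) =
      exp φ * lap (dot φ φ) + dot (exp φ) (dot φ φ) := by
    simp only [lap_def, dot.eq_1 (exp φ), Derivation.leibniz, smul_eq_mul, Finset.mul_sum,
      ← Finset.sum_add_distrib]
    exact Finset.sum_congr rfl fun i _ => by ring
  have h2 := D.int_mul_lap (lap φ) hU
  have h3 := D.int_mul_lap (dot φ φ) hU
  have hid : lap (exp φ) * (2 * lap φ + dot φ φ) - (2:ℝ) • (exp φ * hessSq φ) =
      (2:ℝ) • (lap φ * lap (exp φ) + dot (lap φ) (exp φ)) +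
        (dot φ φ * lap (exp φ) + dot (dot φ φ) (exp φ)) -
        ∑ i, pderiv i (exp φ * pderiv i (dot φ φ)) := by
    rw [hdiv, lap_dot_self, dot_comm (lap φ), dot_comm (dot φ φ) (exp φ), dot_exp φ (lap φ)]
    simp only [two_smul]
    ring
  have h4 := congrArg D.int hid
  simp only [map_sub, map_add, map_smul, smul_eq_mul, h2, h3] at h4
  have h5 : D.int (∑ i, pderiv i (exp φ * pderiv i (dot φ φ))) ≤ 0 := h1
  linarith

end SmoothDomain

/-! ### The second derivative of the entropy along the flow -/

/-- Pairs of smooth functions. -/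
abbrev SmoothPair (d : ℕ) : Type := Fin 2 → SmoothFun d

open SmoothFun

/-- The operator `A` with equal diffusion coefficients, as a linear operator on smooth pairs. -/
def diffOp (ρ μ : ℝ) : SmoothPair d →ₗ[ℝ] SmoothPair d where
  toFun u l := -(ρ • lap (u l) + μ • (u (1 - l) - u l))
  map_add' u v := by
    funext l
    simp only [Pi.add_apply, map_add]
    module
  map_smul' c u := by
    funext l
    simp only [Pi.smul_apply, map_smul, RingHom.id_apply]
    module

theorem diffOp_apply (ρ μ : ℝ) (u : SmoothPair d) (l : Fin 2) :
    diffOp ρ μ u l = -(ρ • lap (u l) + μ • (u (1 - l) - u l)) := rfl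

theorem diffOp_congr {ρ μ : ℝ} {u v : SmoothPair d} {x} (H : ∀ l, u l =ᶠ[𝓝 x] v l) (l : Fin 2) :
    diffOp ρ μ u l =ᶠ[𝓝 x] diffOp ρ μ v l := by
  filter_upwards [lap_congr (H l), H l, H (1 - l)] with y h1 h2 h3
  simp [diffOp_apply, h1, h2, h3]

theorem diffOp_pow_congr {ρ μ : ℝ} {u v : SmoothPair d} {x} (H : ∀ l, u l =ᶠ[𝓝 x] v l) (k : ℕ) :
    ∀ l, (diffOp ρ μ ^ k) u l =ᶠ[𝓝 x] (diffOp ρ μ ^ k) v l := by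
  induction k with
  | zero => exact H
  | succ k ih =>
    intro l
    rw [pow_succ', Module.End.mul_apply, Module.End.mul_apply]
    exact diffOp_congr ih l

namespace SmoothDomain
variable (D : SmoothDomain d)

/-- The `L²` inner product of two pairs over the domain. -/
def pairing : SmoothPair d →ₗ[ℝ] SmoothPair d →ₗ[ℝ] ℝ :=
  LinearMap.mk₂ ℝ (fun u v => D.int (∑ l, u l * v l))
    (fun u u' v => by simp [add_mul, Finset.sum_add_distrib])
    (fun c u v => by simp [mul_add])
    (fun u v v' => by simp [mul_add, Finset.sum_add_distrib])
    (fun c u v => by simp [mul_add])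

theorem pairing_apply (u v : SmoothPair d) : D.pairing u v = D.int (∑ l, u l * v l) := rfl

/-- Both components satisfy the homogeneous Neumann condition. -/
def NeumannPair (u : SmoothPair d) : Prop := ∀ l, D.Neumann (u l)

/-- The operator `A` is symmetric on pairs that satisfy the Neumann conditions. -/
theorem pairing_diffOp {ρ μ : ℝ} {u v : SmoothPair d} (hu : D.NeumannPair u)
    (hv : D.NeumannPair v) :
    D.pairing (diffOp ρ μ u) v = D.pairing u (diffOp ρ μ v) := by
  have h0 := D.int_mul_lap_symm (hu 0) (hv 0)
  have h1 := D.int_mul_lap_symm (hu 1) (hv 1)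
  have key : ∑ l, diffOp ρ μ u l * v l - ∑ l, u l * diffOp ρ μ v l =
      ρ • (u 0 * lap (v 0) - lap (u 0) * v 0 + (u 1 * lap (v 1) - lap (u 1) * v 1)) := by
    ext x
    simp [diffOp_apply]
    ring
  rw [pairing_apply, pairing_apply, ← sub_eq_zero, ← map_sub, key]
  simp [h0, h1]

/-- The cross term of the second derivative of the entropy is a weighted Dirichlet integral of
the difference of the logarithms. -/
theorem int_cross_term {φ ψ : SmoothFun d} (hφ : D.Neumann φ) (hψ : D.Neumann ψ) :
    D.int ((ψ - φ) * (lap (exp φ) - lap (exp ψ)) + (exp ψ - exp φ) * (lap φ - lap ψ) +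
      2 * ((exp ψ - exp φ) * (lap φ + dot φ φ) + (exp φ - exp ψ) * (lap ψ + dot ψ ψ))) =
    2 * D.int ((exp φ + exp ψ) * dot (φ - ψ) (φ - ψ)) := by
  have hU := hφ.exp
  have hV := hψ.exp
  have a1 := D.int_mul_lap (ψ - φ) hU
  have a2 := D.int_mul_lap (ψ - φ) hV
  have a3 := D.int_mul_lap (exp ψ - exp φ) hφ
  have a4 := D.int_mul_lap (exp ψ - exp φ) hψ
  have key : (ψ - φ) * (lap (exp φ) - lap (exp ψ)) + (exp ψ - exp φ) * (lap φ - lap ψ) +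
      2 * ((exp ψ - exp φ) * (lap φ + dot φ φ) + (exp φ - exp ψ) * (lap ψ + dot ψ ψ)) =
      ((ψ - φ) * lap (exp φ) + dot (ψ - φ) (exp φ)) -
      ((ψ - φ) * lap (exp ψ) + dot (ψ - φ) (exp ψ)) +
      (3:ℝ) • ((exp ψ - exp φ) * lap φ + dot (exp ψ - exp φ) φ) -
      (3:ℝ) • ((exp ψ - exp φ) * lap ψ + dot (exp ψ - exp φ) ψ) +
      (2:ℝ) • ((exp φ + exp ψ) * dot (φ - ψ) (φ - ψ)) := by
    have e1 : ∀ h k : SmoothFun d, dot h (exp k) = exp k * dot h k := fun h k => by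
      rw [dot_comm, dot_exp, dot_comm]
    have e2 : dot (φ - ψ) (φ - ψ) = dot φ φ - 2 * dot φ ψ + dot ψ ψ := by
      rw [dot_sub_left, dot_comm φ, dot_comm ψ, dot_sub_left, dot_sub_left, dot_comm ψ φ]
      ring
    simp only [dot_sub_left, dot_exp, e1, e2, dot_comm ψ φ]
    ext x
    simp
    have e3 : ((2 : SmoothFun d) : SmoothFun d) x = 2 := rfl
    simp only [e3]
    ring
  rw [key]
  simp only [map_add, map_sub, map_smul, smul_eq_mul, a1, a2, a3, a4]
  ring

/-- The entropy of a solution of the system is strictly convex in time away from steady states: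
its second derivative `⟨A φ, A U⟩ + ∫ |A U|² / U`, with `U = exp φ`, is positive. -/
theorem second_derivative_pos (hconv : Convex ℝ D.inside) {ρ μ : ℝ} (hρ : 0 < ρ) (hμ : 0 < μ)
    {φ : SmoothPair d} (hφ : D.NeumannPair φ)
    (hne : ¬ ∀ l x, D.g x < 0 → diffOp ρ μ (fun l => exp (φ l)) l x = 0) :
    0 < D.pairing (diffOp ρ μ φ) (diffOp ρ μ fun l => exp (φ l)) +
      D.int (∑ l, diffOp ρ μ (fun l => exp (φ l)) l ^ 2 * exp (-φ l)) := by
  set U := exp (φ 0) with hU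
  set V := exp (φ 1) with hV
  set M : SmoothFun d := (2:ℝ) • ((U - V) * (φ 0 - φ 1)) + (U - V) ^ 2 * (exp (-φ 0) + exp (-φ 1)) with hM
  set heat : Fin 2 → SmoothFun d :=
    fun l => lap (exp (φ l)) * (2 * lap (φ l) + dot (φ l) (φ l)) with hheat
  set X : SmoothFun d := (φ 1 - φ 0) * (lap U - lap V) + (V - U) * (lap (φ 0) - lap (φ 1)) +
      2 * ((V - U) * (lap (φ 0) + dot (φ 0) (φ 0)) + (U - V) * (lap (φ 1) + dot (φ 1) (φ 1))) with hX
  have hQ : D.pairing (diffOp ρ μ φ) (diffOp ρ μ fun l => exp (φ l)) +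
      D.int (∑ l, diffOp ρ μ (fun l => exp (φ l)) l ^ 2 * exp (-φ l)) =
      ρ ^ 2 * (D.int (heat 0) + D.int (heat 1)) + μ ^ 2 * D.int M + ρ * μ * D.int X := by
    have : ∑ l, diffOp ρ μ φ l * diffOp ρ μ (fun l => exp (φ l)) l +
        ∑ l, diffOp ρ μ (fun l => exp (φ l)) l ^ 2 * exp (-φ l) =
        (ρ ^ 2) • (heat 0 + heat 1) + (μ ^ 2) • M + (ρ * μ) • X := by
      have h0 : ∀ l x, Real.exp (φ l x) * Real.exp (-φ l x) = 1 := fun l x => by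
        rw [← Real.exp_add]; simp
      have e3 : ∀ x, ((2 : SmoothFun d) : SmoothFun d) x = 2 := fun _ => rfl
      ext x
      have k0 := h0 0 x
      have k1 := h0 1 x
      simp [diffOp_apply, hheat, hM, hX, lap_exp, hU, hV, e3]
      generalize Real.exp (φ 0 x) = p at *
      generalize Real.exp (φ 1 x) = q at *
      generalize Real.exp (-φ 0 x) = p' at *
      generalize Real.exp (-φ 1 x) = q' at *
      generalize lap (φ 0) x = a at *
      generalize lap (φ 1) x = b at *
      generalize dot (φ 0) (φ 0) x = a' at *
      generalize dot (φ 1) (φ 1) x = b' at *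
      linear_combination (p * ρ ^ 2 * (a + a') ^ 2 + 2 * ρ * μ * (a + a') * (q - p)) * k0 +
        (q * ρ ^ 2 * (b + b') ^ 2 + 2 * ρ * μ * (b + b') * (p - q)) * k1
    rw [pairing_apply, ← map_add, this]
    simp only [map_add, map_smul, smul_eq_mul]
  have hXint : D.int X = 2 * D.int ((U + V) * dot (φ 0 - φ 1) (φ 0 - φ 1)) :=
    D.int_cross_term (hφ 0) (hφ 1)
  have hX0 : 0 ≤ D.int X := by
    rw [hXint]
    refine mul_nonneg zero_le_two (D.int_nonneg fun x _ => ?_)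
    simp only [mul_apply, SmoothFun.add_apply, hU, hV, exp_apply]
    exact mul_nonneg (by positivity) (dot_self_nonneg _ _)
  have hMx : ∀ x, (U x - V x) ^ 2 * Real.exp (-φ 0 x) ≤ M x := by
    intro x
    have hmono : 0 ≤ (U x - V x) * (φ 0 x - φ 1 x) := by
      simp only [hU, hV, exp_apply]
      rcases le_total (φ 0 x) (φ 1 x) with h | h
      · exact mul_nonneg_of_nonpos_of_nonpos (sub_nonpos.2 (Real.exp_le_exp.2 h))
          (sub_nonpos.2 h)
      · exact mul_nonneg (sub_nonneg.2 (Real.exp_le_exp.2 h)) (sub_nonneg.2 h)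
    have h2 : 0 ≤ (U x - V x) ^ 2 * Real.exp (-φ 1 x) := by positivity
    simp only [hM, SmoothFun.add_apply, mul_apply, SmoothFun.sub_apply, pow_apply, exp_apply,
      SmoothFun.neg_apply, SmoothFun.smul_apply]
    nlinarith
  have hM0 : ∀ x, 0 ≤ M x := fun x => le_trans (by positivity) (hMx x)
  have hMint : 0 ≤ D.int M := D.int_nonneg fun x _ => hM0 x
  have hh : ∀ l, 0 ≤ D.int (exp (φ l) * hessSq (φ l)) := fun l => D.int_nonneg fun x _ =>
    mul_nonneg (Real.exp_pos _).le (hessSq_nonneg _ _)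
  have hheat2 : ∀ l, 2 * D.int (exp (φ l) * hessSq (φ l)) ≤ D.int (heat l) := fun l =>
    D.two_mul_int_exp_mul_hessSq_le hconv (hφ l)
  rw [hQ]
  by_contra hcon
  push Not at hcon
  have hρ2 : 0 < ρ ^ 2 := by positivity
  have hμ2 : 0 < μ ^ 2 := by positivity
  have t1 : 0 ≤ ρ ^ 2 * (D.int (heat 0) + D.int (heat 1)) :=
    mul_nonneg hρ2.le (by linarith [hh 0, hh 1, hheat2 0, hheat2 1])
  have t2 : 0 ≤ μ ^ 2 * D.int M := by positivity
  have t3 : 0 ≤ ρ * μ * D.int X := by positivity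
  have z1 : D.int (heat 0) + D.int (heat 1) = 0 :=
    (mul_eq_zero.1 (show ρ ^ 2 * (D.int (heat 0) + D.int (heat 1)) = 0 by linarith)).resolve_left
      hρ2.ne'
  have z2 : D.int M = 0 :=
    (mul_eq_zero.1 (show μ ^ 2 * D.int M = 0 by linarith)).resolve_left hμ2.ne'
  have z3 : ∀ l, D.int (exp (φ l) * hessSq (φ l)) = 0 := by
    have := hh 0; have := hh 1; have := hheat2 0; have := hheat2 1
    intro l
    fin_cases l <;> simp only [Fin.zero_eta, Fin.mk_one] <;> linarith
  -- a vanishing Hessian makes `φ l` harmonic, hence of zero Dirichlet energy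
  have hlap : ∀ l x, D.g x < 0 → lap (φ l) x = 0 := by
    intro l x hx
    have := D.eq_zero_of_int_eq_zero
      (fun x _ => mul_nonneg (Real.exp_pos _).le (hessSq_nonneg (φ l) x)) (z3 l) x hx
    rw [mul_apply, exp_apply] at this
    exact lap_eq_zero_of_hessSq ((mul_eq_zero.1 this).resolve_left (Real.exp_ne_zero _))
  have hdot : ∀ l x, D.g x < 0 → dot (φ l) (φ l) x = 0 := by
    intro l
    apply D.eq_zero_of_int_eq_zero fun x _ => dot_self_nonneg _ _
    have h1 := D.int_mul_lap (φ l) (hφ l)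
    have h2 : D.int (φ l * lap (φ l)) = D.int 0 :=
      D.int_congr fun x hx => by rw [mul_apply, hlap l x hx, mul_zero]; rfl
    rw [map_zero] at h2
    linarith
  have hUV : ∀ x, D.g x < 0 → U x = V x := by
    intro x hx
    have h1 := D.eq_zero_of_int_eq_zero (fun x _ => hM0 x) z2 x hx
    have h2 := hMx x
    rw [h1] at h2
    have h3 : (U x - V x) ^ 2 ≤ 0 := by
      by_contra h
      push Not at h
      linarith [mul_pos h (Real.exp_pos (-φ 0 x))]
    exact sub_eq_zero.1 (pow_eq_zero_iff two_ne_zero |>.1 (le_antisymm h3 (sq_nonneg _)))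
  refine hne fun l x hx => ?_
  have h1 := hUV x hx
  simp only [hU, hV, exp_apply] at h1
  fin_cases l <;> simp [diffOp_apply, lap_exp, hlap _ x hx, hdot _ x hx, h1]

end SmoothDomain

/-! ### Test functions adapted to powers of the operator -/

theorem contDiff_deriv {θ : ℝ → ℝ} (hθ : ContDiff ℝ ∞ θ) : ContDiff ℝ ∞ (deriv θ) :=
  ((contDiff_succ_iff_deriv (n := ∞)).1 hθ).2.2

/-- A function which is smooth on `(0, ∞)` agrees on `[m, ∞)` with a function smooth on `ℝ`. -/
theorem exists_contDiff_extension {F : ℝ → ℝ} (hF : ∀ t, 0 < t → ContDiffAt ℝ ∞ F t) {m : ℝ}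
    (hm : 0 < m) : ∃ G : ℝ → ℝ, ContDiff ℝ ∞ G ∧ ∀ t, m ≤ t → G t = F t := by
  refine ⟨fun t => Real.smoothTransition (2 * t / m - 1) * F t, ?_, fun t ht => ?_⟩
  · rw [contDiff_iff_contDiffAt]
    intro t
    rcases lt_or_ge 0 t with h | h
    · refine ContDiffAt.mul ?_ (hF t h)
      exact (Real.smoothTransition.contDiff.comp (by fun_prop)).contDiffAt
    · have hev : (fun t => Real.smoothTransition (2 * t / m - 1) * F t) =ᶠ[𝓝 t] fun _ => 0 := by
        filter_upwards [gt_mem_nhds (show t < m / 2 by linarith)] with s hs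
        have : 2 * s / m ≤ 1 := by rw [div_le_one hm]; linarith
        rw [Real.smoothTransition.zero_of_nonpos (by linarith), zero_mul]
      exact contDiffAt_const.congr_of_eventuallyEq hev
  · have : 2 ≤ 2 * t / m := by rw [le_div_iff₀ hm]; linarith
    change Real.smoothTransition _ * F t = F t
    rw [Real.smoothTransition.one_of_one_le (by linarith), one_mul]

namespace SmoothFun

theorem pderiv_comp_deriv {G : ℝ → ℝ} (hG : ContDiff ℝ ∞ G) (f : SmoothFun d) (i : Fin d) :
    pderiv i (comp G hG f) = comp (deriv G) (contDiff_deriv hG) f * pderiv i f :=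
  pderiv_comp _ _ _ _ (fun t => (hG.differentiable (by simp) t).hasDerivAt) f i

theorem dot_comp {G : ℝ → ℝ} (hG : ContDiff ℝ ∞ G) (f h : SmoothFun d) :
    dot (comp G hG f) h = comp (deriv G) (contDiff_deriv hG) f * dot f h := by
  simp only [dot, pderiv_comp_deriv, Finset.mul_sum, mul_assoc]

theorem lap_comp {G : ℝ → ℝ} (hG : ContDiff ℝ ∞ G) (f : SmoothFun d) :
    lap (comp G hG f) = comp (deriv (deriv G)) (contDiff_deriv (contDiff_deriv hG)) f * dot f f +
      comp (deriv G) (contDiff_deriv hG) f * lap f := by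
  simp only [lap_def, pderiv_comp_deriv, Derivation.leibniz, smul_eq_mul, dot, Finset.mul_sum,
    ← Finset.sum_add_distrib]
  exact Finset.sum_congr rfl fun i _ => by ring

theorem dot_pow (f h : SmoothFun d) (n : ℕ) :
    dot (f ^ (n + 1)) h = (n + 1 : ℝ) • (f ^ n * dot f h) := by
  induction n with
  | zero => simp
  | succ n ih =>
    rw [pow_succ, dot_mul_left, ih]
    ext x
    simp
    ring

theorem lap_pow (f : SmoothFun d) (n : ℕ) :
    lap (f ^ (n + 2)) = ((n + 2) * (n + 1) : ℝ) • (f ^ n * dot f f) +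
      (n + 2 : ℝ) • (f ^ (n + 1) * lap f) := by
  have e2 : ∀ x, ((2 : SmoothFun d) : SmoothFun d) x = 2 := fun _ => rfl
  induction n with
  | zero =>
    rw [zero_add, pow_two, lap_mul]
    ext x
    simp [e2]
    ring
  | succ n ih =>
    rw [show n + 1 + 2 = (n + 2) + 1 from rfl, pow_succ, lap_mul, ih, dot_pow]
    ext x
    simp [e2]
    ring

end SmoothFun

namespace SmoothDomain
variable (D : SmoothDomain d)

/-- The pair `θ(g/h) B`, concentrated in a boundary layer of width `h` if `θ` has compact
support. -/
def layer (θ : ℝ → ℝ) (hθ : ContDiff ℝ ∞ θ) (h : ℝ) (B : SmoothPair d) : SmoothPair d :=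
  fun l => comp (fun t => θ (h⁻¹ * t)) (hθ.comp (by fun_prop)) D.g * B l

theorem layer_apply (θ : ℝ → ℝ) (hθ) (h : ℝ) (B : SmoothPair d) (l x) :
    D.layer θ hθ h B l x = θ (h⁻¹ * D.g x) * B l x := rfl

theorem diffOp_layer (ρ μ : ℝ) (θ : ℝ → ℝ) (hθ : ContDiff ℝ ∞ θ) (h : ℝ) (B : SmoothPair d) :
    diffOp ρ μ (D.layer θ hθ h B) =
      (h⁻¹ ^ 2) • D.layer (deriv (deriv θ)) (contDiff_deriv (contDiff_deriv hθ)) h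
        (fun l => -(ρ • (dot D.g D.g * B l))) +
      h⁻¹ • D.layer (deriv θ) (contDiff_deriv hθ) h
        (fun l => -(ρ • (2 * dot D.g (B l) + lap D.g * B l))) +
      D.layer θ hθ h (diffOp ρ μ B) := by
  have h1 : deriv (fun t => θ (h⁻¹ * t)) = fun t => h⁻¹ * deriv θ (h⁻¹ * t) := by
    funext t
    exact deriv_comp_mul_left h⁻¹ θ t
  have h2 : deriv (deriv (fun t => θ (h⁻¹ * t))) =
      fun t => h⁻¹ * (h⁻¹ * deriv (deriv θ) (h⁻¹ * t)) := by
    rw [h1]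
    funext t
    rw [deriv_const_mul_field, ← smul_eq_mul h⁻¹ (deriv (deriv θ) (h⁻¹ * t)),
      deriv_comp_mul_left h⁻¹ (deriv θ) t]
  rw [h1] at h2
  have e2 : ∀ x, ((2 : SmoothFun d) : SmoothFun d) x = 2 := fun _ => rfl
  funext l
  ext x
  simp only [diffOp_apply, Pi.add_apply, Pi.smul_apply, SmoothFun.add_apply, SmoothFun.smul_apply,
    SmoothFun.neg_apply, SmoothFun.sub_apply, layer, mul_apply, lap_mul, dot_comp, lap_comp,
    comp_apply, h2, h1, e2]
  ring

/-- Each power of `A` costs at most a factor `h⁻²` on a boundary layer of width `h`. -/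
theorem exists_bound_layer (ρ μ : ℝ) (k : ℕ) : ∀ (θ : ℝ → ℝ) (hθ : ContDiff ℝ ∞ θ)
    (_ : HasCompactSupport θ) (B : SmoothPair d), ∃ C, 0 ≤ C ∧ ∀ h : ℝ, 0 < h → h ≤ 1 →
      ∀ l x, D.g x ≤ 0 → |(diffOp ρ μ ^ k) (D.layer θ hθ h B) l x| ≤ C * h⁻¹ ^ (2 * k) := by
  induction k with
  | zero =>
    intro θ hθ hc B
    obtain ⟨C, hC⟩ := hθ.continuous.bounded_above_of_compact_support hc
    obtain ⟨C₀, hC₀, hB₀⟩ := D.exists_bound (B 0)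
    obtain ⟨C₁, hC₁, hB₁⟩ := D.exists_bound (B 1)
    have hC0 : 0 ≤ C := (norm_nonneg _).trans (hC 0)
    refine ⟨C * (C₀ + C₁), by positivity, fun h _ _ l x hx => ?_⟩
    have hB : |B l x| ≤ C₀ + C₁ := by
      fin_cases l
      · exact (hB₀ x hx).trans (by linarith)
      · exact (hB₁ x hx).trans (by linarith)
    simp only [pow_zero, Module.End.one_apply, layer_apply, abs_mul, mul_zero, mul_one]
    exact mul_le_mul (hC _) hB (abs_nonneg _) hC0
  | succ k ih =>
    intro θ hθ hc B
    obtain ⟨C₁, hC₁, h₁⟩ := ih _ (contDiff_deriv (contDiff_deriv hθ)) hc.deriv.deriv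
      (fun l => -(ρ • (dot D.g D.g * B l)))
    obtain ⟨C₂, hC₂, h₂⟩ := ih _ (contDiff_deriv hθ) hc.deriv
      (fun l => -(ρ • (2 * dot D.g (B l) + lap D.g * B l)))
    obtain ⟨C₃, hC₃, h₃⟩ := ih _ hθ hc (diffOp ρ μ B)
    refine ⟨C₁ + C₂ + C₃, by positivity, fun h h0 hle l x hx => ?_⟩
    have hinv : 1 ≤ h⁻¹ := (one_le_inv₀ h0).2 hle
    rw [pow_succ, Module.End.mul_apply, diffOp_layer]
    simp only [map_add, map_smul, Pi.add_apply, Pi.smul_apply, SmoothFun.add_apply,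
      SmoothFun.smul_apply]
    have b₁ := h₁ h h0 hle l x hx
    have b₂ := h₂ h h0 hle l x hx
    have b₃ := h₃ h h0 hle l x hx
    have hp : 0 ≤ h⁻¹ ^ (2 * k) := by positivity
    have hsq : h⁻¹ ≤ h⁻¹ ^ 2 := by nlinarith
    have hsq1 : 1 ≤ h⁻¹ ^ 2 := by nlinarith
    refine (abs_add_three _ _ _).trans ?_
    rw [abs_mul, abs_mul, abs_of_pos (show 0 < h⁻¹ ^ 2 by positivity),
      abs_of_pos (show 0 < h⁻¹ by positivity)]
    have c₁ := mul_le_mul_of_nonneg_left b₁ (show 0 ≤ h⁻¹ ^ 2 by positivity)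
    have c₂ := mul_le_mul hsq b₂ (abs_nonneg _) (by positivity)
    have c₃ := b₃.trans (le_mul_of_one_le_left (mul_nonneg hC₃ hp) hsq1)
    rw [show 2 * (k + 1) = 2 * k + 2 by ring, pow_add]
    linarith

theorem diffOp_pow_mul (ρ μ : ℝ) (n : ℕ) (c : SmoothPair d) : ∃ c' : SmoothPair d,
    diffOp ρ μ (fun l => D.g ^ (n + 2) * c l) =
      (fun l => D.g ^ n * ((-(ρ * ((n + 2) * (n + 1)))) • (dot D.g D.g * c l))) +
      fun l => D.g ^ (n + 1) * c' l := by
  refine ⟨fun l => (-(ρ * (n + 2))) • (2 * dot D.g (c l) + lap D.g * c l) +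
    D.g * diffOp ρ μ c l, ?_⟩
  have e2 : ∀ x, ((2 : SmoothFun d) : SmoothFun d) x = 2 := fun _ => rfl
  funext l
  ext x
  have hd := dot_pow D.g (c l) (n + 1)
  simp only [diffOp_apply, Pi.add_apply, SmoothFun.add_apply, SmoothFun.smul_apply,
    SmoothFun.neg_apply, SmoothFun.sub_apply, mul_apply, lap_mul, hd, lap_pow, e2, pow_apply]
  push_cast
  ring

/-- The power `Aᵏ` lowers the order of vanishing at the boundary from `n + 2k` to `n`, with an
explicit leading term. -/
theorem diffOp_pow_pow_mul {ρ : ℝ} (hρ : ρ ≠ 0) (μ : ℝ) (k : ℕ) : ∀ n : ℕ, ∃ κ : ℝ, κ ≠ 0 ∧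
    ∀ c : SmoothPair d, ∃ c' : SmoothPair d,
      (diffOp ρ μ ^ k) (fun l => D.g ^ (n + 2 * k) * c l) =
      (fun l => D.g ^ n * (κ • (dot D.g D.g ^ k * c l))) + fun l => D.g ^ (n + 1) * c' l := by
  induction k with
  | zero =>
    refine fun n => ⟨1, one_ne_zero, fun c => ⟨0, ?_⟩⟩
    funext l
    simp
  | succ k ih =>
    intro n
    obtain ⟨κ, hκ, h⟩ := ih n
    obtain ⟨κ₁, -, h₁⟩ := ih (n + 1)
    refine ⟨κ * (-(ρ * (((n + 2 * k : ℕ) + 2) * ((n + 2 * k : ℕ) + 1)))), ?_, fun c => ?_⟩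
    · refine mul_ne_zero hκ (neg_ne_zero.2 (mul_ne_zero hρ ?_))
      positivity
    · obtain ⟨c₁, e₁⟩ := D.diffOp_pow_mul ρ μ (n + 2 * k) c
      obtain ⟨c₂, e₂⟩ :=
        h fun l => (-(ρ * (((n + 2 * k : ℕ) + 2) * ((n + 2 * k : ℕ) + 1)))) • (dot D.g D.g * c l)
      obtain ⟨c₃, e₃⟩ := h₁ c₁
      refine ⟨c₂ + (fun l => κ₁ • (dot D.g D.g ^ k * c₁ l)) + fun l => D.g * c₃ l, ?_⟩
      rw [show n + 2 * (k + 1) = n + 2 * k + 2 by ring, pow_succ, Module.End.mul_apply, e₁,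
        map_add, e₂, show n + 2 * k + 1 = n + 1 + 2 * k by ring, e₃]
      funext l
      ext x
      simp only [Pi.add_apply, SmoothFun.add_apply, SmoothFun.smul_apply, mul_apply, pow_apply]
      ring

theorem Neumann.sub {f h : SmoothFun d} (hf : D.Neumann f) (hh : D.Neumann h) :
    D.Neumann (f - h) := fun x hx => by
  rw [dot_sub_left, SmoothFun.sub_apply, hf x hx, hh x hx, sub_zero]

theorem neumann_sq_mul (f : SmoothFun d) (n : ℕ) : D.Neumann (D.g ^ (n + 2) * f) := fun x hx => by
  rw [dot_mul_left, dot_pow]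
  simp [hx]

theorem exists_boundary_inverse : ∃ r : SmoothFun d, ∀ x, D.g x = 0 → r x * dot D.g D.g x = 1 := by
  obtain ⟨m, hm, hle⟩ := D.isCompact_boundary.exists_forall_le' (a := 0)
    (dot D.g D.g).continuous.continuousOn
    (fun x hx => lt_of_le_of_ne (dot_self_nonneg D.g x) (D.dot_self_ne_zero x hx).symm)
  obtain ⟨G, hG, hGeq⟩ := exists_contDiff_extension (F := fun t => t⁻¹)
    (fun t ht => contDiffAt_inv ℝ ht.ne') hm
  refine ⟨comp G hG (dot D.g D.g), fun x hx => ?_⟩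
  rw [comp_apply, hGeq _ (hle x hx), inv_mul_cancel₀ (D.dot_self_ne_zero x hx)]

/-- A pair satisfying the Neumann conditions can be changed to third order at the boundary, so that
its images under the first `n` powers of `A` satisfy them too: the normal derivative of
`A^{k+1}` is corrected by a multiple of `g^{2k+3}`, which does not affect the lower powers. -/
theorem exists_correction {ρ : ℝ} (hρ : ρ ≠ 0) (μ : ℝ) {φ : SmoothPair d}
    (hφ : D.NeumannPair φ) (n : ℕ) : ∃ B : SmoothPair d, ∀ k ≤ n,
      D.NeumannPair ((diffOp ρ μ ^ k) (φ - fun l => D.g ^ 3 * B l)) := by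
  induction n with
  | zero =>
    refine ⟨0, fun k hk l => ?_⟩
    obtain rfl : k = 0 := by omega
    have : (φ - fun l => D.g ^ 3 * (0 : SmoothPair d) l) = φ := by
      funext l; simp
    rw [this]
    exact hφ l
  | succ n ih =>
    obtain ⟨B, hB⟩ := ih
    obtain ⟨r, hr⟩ := D.exists_boundary_inverse
    obtain ⟨κ, hκ, hpow⟩ := D.diffOp_pow_pow_mul hρ μ (n + 1) 1
    set c : SmoothPair d := fun l => κ⁻¹ • (r ^ (n + 2) *
      dot ((diffOp ρ μ ^ (n + 1)) (φ - fun l => D.g ^ 3 * B l) l) D.g) with hc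
    refine ⟨fun l => B l + D.g ^ (2 * n) * c l, fun k hk => ?_⟩
    have hsplit : (φ - fun l => D.g ^ 3 * (B l + D.g ^ (2 * n) * c l)) =
        (φ - fun l => D.g ^ 3 * B l) - fun l => D.g ^ (2 * n + 3) * c l := by
      funext l
      simp only [Pi.sub_apply]
      ring
    rw [hsplit, map_sub]
    rcases Nat.lt_or_ge n k with h | h
    · obtain rfl : k = n + 1 := by omega
      obtain ⟨c', hc'⟩ := hpow c
      rw [show 1 + 2 * (n + 1) = 2 * n + 3 by ring] at hc'
      intro l x hx
      have h2 := D.neumann_sq_mul (c' l) 0 x hx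
      rw [hc', Pi.sub_apply, Pi.add_apply, dot_sub_left, dot_add_left]
      rw [SmoothFun.sub_apply, SmoothFun.add_apply]
      rw [show (1 + 1 : ℕ) = 0 + 2 from rfl, h2, pow_one, dot_mul_left, SmoothFun.add_apply,
        mul_apply, mul_apply, hx]
      simp only [hc, SmoothFun.smul_apply, mul_apply, pow_apply]
      have h3 : r x ^ (n + 2) * dot D.g D.g x ^ (n + 1) * dot D.g D.g x = 1 := by
        rw [mul_assoc, ← pow_succ, ← mul_pow, hr x hx, one_pow]
      field_simp
      linear_combination
        (-dot ((diffOp ρ μ ^ (n + 1)) (φ - fun l => D.g ^ 3 * B l) l) D.g x) * h3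
    · obtain ⟨κ', -, hpow'⟩ := D.diffOp_pow_pow_mul hρ μ k (2 * (n - k) + 3)
      obtain ⟨c', hc'⟩ := hpow' c
      rw [show 2 * (n - k) + 3 + 2 * k = 2 * n + 3 by omega] at hc'
      intro l
      refine (hB k h l).sub D ?_
      rw [hc']
      have : (D.g ^ (2 * (n - k) + 3) * (κ' • (dot D.g D.g ^ k * c l)) +
          D.g ^ (2 * (n - k) + 3 + 1) * c' l) = D.g ^ (2 * (n - k) + 1 + 2) *
          (κ' • (dot D.g D.g ^ k * c l) + D.g * c' l) := by ring
      rw [Pi.add_apply, this]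
      exact D.neumann_sq_mul _ _

/-- A smooth bump function of one variable, equal to `1` on `[-1/2, 1/2]` and supported
in `[-1, 1]`. -/
def bump : ContDiffBump (0 : ℝ) := ⟨1 / 2, 1, by norm_num, by norm_num⟩

theorem bump_eventually_eq_one (h : ℝ) {x} (hx : D.g x = 0) :
    ∀ᶠ y in 𝓝 x, bump (h⁻¹ * D.g y) = 1 := by
  have hc : Continuous fun y => |h⁻¹ * D.g y| := by
    have := D.g.continuous
    fun_prop
  filter_upwards [(hc.tendsto x).eventually
    (gt_mem_nhds (show |h⁻¹ * D.g x| < 1 / 2 by simp [hx]))] with y hy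
  refine bump.one_of_mem_closedBall ?_
  rw [Metric.mem_closedBall, dist_zero_right, Real.norm_eq_abs]
  exact hy.le

theorem neumannPair_congr {u v : SmoothPair d}
    (H : ∀ x, D.g x = 0 → ∀ l, u l =ᶠ[𝓝 x] v l) (hv : D.NeumannPair v) : D.NeumannPair u :=
  fun l x hx => by rw [(dot_congr_left (H x hx l) D.g).self_of_nhds]; exact hv l x hx

/-- Smoothed test pairs: `φ` is approximated to order `h³` by pairs whose images under the powers
of `A` up to `n` satisfy the Neumann conditions, with a loss of `h⁻²` for each power. -/
theorem exists_approximation {ρ : ℝ} (hρ : ρ ≠ 0) (μ : ℝ) {φ : SmoothPair d}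
    (hφ : D.NeumannPair φ) (n : ℕ) : ∃ (Φ : ℝ → SmoothPair d) (C : ℕ → ℝ), (∀ k, 0 ≤ C k) ∧
      ∀ h, 0 < h → h ≤ 1 → (∀ k ≤ n, D.NeumannPair ((diffOp ρ μ ^ k) (Φ h))) ∧
        ∀ k l x, D.g x ≤ 0 →
          |(diffOp ρ μ ^ k) (φ - Φ h) l x| ≤ C k * (h ^ 3 * h⁻¹ ^ (2 * k)) := by
  obtain ⟨B, hB⟩ := D.exists_correction hρ μ hφ n
  have hθ : ContDiff ℝ ∞ fun t : ℝ => bump t * t ^ 3 := bump.contDiff.mul (by fun_prop)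
  have hs : HasCompactSupport fun t : ℝ => bump t * t ^ 3 := bump.hasCompactSupport.mul_right
  choose C hC0 hC using fun k => D.exists_bound_layer ρ μ k _ hθ hs B
  refine ⟨fun h => φ - (h ^ 3) • D.layer _ hθ h B, C, hC0, fun h h0 h1 => ⟨fun k hk => ?_, ?_⟩⟩
  · refine D.neumannPair_congr (fun x hx => diffOp_pow_congr (fun l => ?_) k) (hB k hk)
    filter_upwards [D.bump_eventually_eq_one h hx] with y hy
    simp only [Pi.sub_apply, Pi.smul_apply, SmoothFun.sub_apply, SmoothFun.smul_apply, layer_apply,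
      hy, mul_apply, pow_apply]
    field_simp
  · intro k l x hx
    have := hC k h h0 h1 l x hx
    rw [sub_sub_cancel, map_smul, Pi.smul_apply, SmoothFun.smul_apply, abs_mul,
      abs_of_pos (by positivity)]
    calc h ^ 3 * _ ≤ h ^ 3 * (C k * h⁻¹ ^ (2 * k)) := mul_le_mul_of_nonneg_left this (by positivity)
      _ = _ := by ring

/-- Multiplication by the cutoff `1 - χ(g/ε)` gives pairs that vanish near the boundary. -/
def truncate (ε : ℝ) (f : SmoothPair d) : SmoothPair d := f - D.layer bump bump.contDiff ε f

theorem neumannPair_truncate (ρ μ ε : ℝ) (f : SmoothPair d) (k : ℕ) :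
    D.NeumannPair ((diffOp ρ μ ^ k) (D.truncate ε f)) := by
  refine D.neumannPair_congr (v := 0)
    (fun x hx l => ?_) (fun l x _ => by simp [dot])
  have h0 := diffOp_pow_congr (ρ := ρ) (μ := μ) (u := D.truncate ε f) (v := 0) (x := x)
    (fun l => ?_) k l
  · rwa [map_zero] at h0
  · filter_upwards [D.bump_eventually_eq_one ε hx] with y hy
    simp [truncate, layer_apply, hy]

end SmoothDomain

/-! ### Elimination of the stages -/

section Elimination
open Polynomial Matrix

variable {s : ℕ}

/-- The stage matrix `1 + X a` over the polynomials; `X` stands for `τ A`. -/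
def stageMatrix (a : Fin s → Fin s → ℝ) : Matrix (Fin s) (Fin s) ℝ[X] :=
  1 + (X : ℝ[X]) • (Matrix.of a).map C

/-- The numerator `bᵀ adj(1 + X a) 𝟙`. -/
def stageSum (a : Fin s → Fin s → ℝ) (b : Fin s → ℝ) : ℝ[X] :=
  ∑ k, C (b k) * ∑ i, (stageMatrix a).adjugate k i

theorem exists_stageSum_eq {a : Fin s → Fin s → ℝ} {b : Fin s → ℝ} (hb : ∑ i, b i = 1)
    (hC : cRK a b = 1) : ∃ e : ℝ[X],
      stageSum a b = (stageMatrix a).det - C (1 / 2) * X * (stageMatrix a).det + X ^ 2 * e := by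
  set N := stageMatrix a with hN
  set M : Matrix (Fin s) (Fin s) ℝ[X] := (Matrix.of a).map C with hM
  have h1 : N.adjugate = N.det • (1 : Matrix (Fin s) (Fin s) ℝ[X]) - (X : ℝ[X]) • (N.adjugate * M) := by
    rw [← Matrix.adjugate_mul N, ← Matrix.mul_smul, ← Matrix.mul_sub]
    have : N - (X : ℝ[X]) • M = 1 := by rw [hN, stageMatrix]; abel
    rw [this, Matrix.mul_one]
  have h2 : N.adjugate = N.det • (1 : Matrix (Fin s) (Fin s) ℝ[X]) - (X * N.det) • M +
      ((X : ℝ[X]) ^ 2) • (N.adjugate * M * M) := by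
    conv_lhs => rw [h1, h1]
    simp only [Matrix.sub_mul, Matrix.smul_mul, Matrix.one_mul, smul_sub, smul_smul]
    rw [pow_two]
    abel
  have hbc : ∑ k, b k * ∑ i, a k i = 1 / 2 := by
    rw [cRK] at hC
    simp only [mul_sub, mul_one, Finset.sum_sub_distrib, hb] at hC
    linarith
  refine ⟨∑ k, C (b k) * ∑ i, (N.adjugate * M * M) k i, ?_⟩
  have h3 : ∀ k i, N.adjugate k i = N.det * (1 : Matrix (Fin s) (Fin s) ℝ[X]) k i -
      X * N.det * C (a k i) + X ^ 2 * (N.adjugate * M * M) k i := by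
    intro k i
    conv_lhs => rw [h2]
    simp [hM]
  have h4 : ∑ k, C (b k) = (1 : ℝ[X]) := by rw [← map_sum, hb, map_one]
  have h5 : ∑ k, C (b k) * ∑ i, C (a k i) = (C (1 / 2) : ℝ[X]) := by
    rw [← hbc]; simp
  rw [stageSum]
  simp only [← hN, h3, Finset.sum_add_distrib, Finset.sum_sub_distrib, ← Finset.mul_sum, mul_add,
    mul_sub, Matrix.one_apply, Finset.sum_ite_eq, Finset.mem_univ, if_true, mul_one]
  have e1 : ∑ k, C (b k) * N.det = N.det := by rw [← Finset.sum_mul, h4, one_mul]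
  have e2 : ∑ k, C (b k) * (X * N.det * ∑ i, C (a k i)) = C (1 / 2) * X * N.det := by
    rw [← h5, Finset.sum_mul, Finset.sum_mul]
    exact Finset.sum_congr rfl fun k _ => by ring
  have e3 : ∑ k, C (b k) * (X ^ 2 * ∑ i, (N.adjugate * M * M) k i) =
      X ^ 2 * ∑ k, C (b k) * ∑ i, (N.adjugate * M * M) k i := by
    rw [Finset.mul_sum]
    exact Finset.sum_congr rfl fun k _ => by ring
  rw [e1, e2, e3]

theorem coeff_zero_det_stageMatrix (a : Fin s → Fin s → ℝ) : (stageMatrix a).det.coeff 0 = 1 := by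
  rw [← constantCoeff_apply, RingHom.map_det]
  have : (constantCoeff (R := ℝ)).mapMatrix (stageMatrix a) = 1 := by
    ext i j
    by_cases h : i = j <;> simp [stageMatrix, Matrix.one_apply, h]
  rw [this, Matrix.det_one]

/-- One step of the scheme, tested against `(τ A)`-iterates of `ψ`: `F i`, `W` and `U` stand for
the pairings with the stages, `w` and `u`. Cramer's rule eliminates the stages. Inverting the
stability polynomial up to fifth order gives the expansion of `W ψ`, where
`cRK = 1` fixes the second-order coefficient. -/
theorem exists_elimination {a : Fin s → Fin s → ℝ} {b : Fin s → ℝ} (hb : ∑ i, b i = 1)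
    (hC : cRK a b = 1) : ∃ (m : ℕ) (T R : ℝ[X]), ∀ (V : Type) [AddCommGroup V] [Module ℝ V]
      (L : Module.End ℝ V) (F : Fin s → V →ₗ[ℝ] ℝ) (W U : V →ₗ[ℝ] ℝ) (ψ : V),
      (∀ Q : ℝ[X], Q.natDegree ≤ m →
        (∀ i, F i (aeval L Q ψ) + ∑ j, a i j * F j (L (aeval L Q ψ)) = W (aeval L Q ψ)) ∧
        U (aeval L Q ψ) = W (aeval L Q ψ) - ∑ j, b j * F j (L (aeval L Q ψ))) →
      W ψ = U ψ + U (L ψ) + 1 / 2 * U (L (L ψ)) + U (aeval L (X ^ 3 * T) ψ) +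
        W (aeval L (X ^ 5 * R) ψ) := by
  obtain ⟨e, he⟩ := exists_stageSum_eq hb hC
  set N := stageMatrix a with hN
  set q := N.det with hq
  set p := q - X * stageSum a b with hp
  obtain ⟨p₁, hp₁⟩ : X ∣ 1 - p := by
    rw [X_dvd_iff, hp]
    simp [hq, hN, coeff_zero_det_stageMatrix]
  set r := ∑ j ∈ Finset.range 5, (1 - p) ^ j with hr
  have hpr : p * r = 1 - X ^ 5 * p₁ ^ 5 := by
    have := mul_neg_geom_sum (1 - p) 5
    rw [sub_sub_cancel] at this
    rw [hr, this, hp₁]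
    ring
  clear_value r
  set T₀ := e * (1 + X + C (1 / 2) * X ^ 2) - C (1 / 2) * C (1 / 2) * q * X with hT₀
  have hc2 : (C (1 / 2) : ℝ[X]) * 2 = 1 := by
    rw [show (2 : ℝ[X]) = C 2 from rfl, ← C_mul]; norm_num
  have hqp : q = p * (1 + X + C (1 / 2) * X ^ 2) + X ^ 3 * T₀ := by
    rw [hp, he, hT₀]
    linear_combination (-X ^ 2 * q) * hc2
  set T := -(1 + X + C (1 / 2) * X ^ 2) * X ^ 2 * p₁ ^ 5 + T₀ * r with hT
  have hqr : q * r = 1 + X + C (1 / 2) * X ^ 2 + X ^ 3 * T := by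
    rw [hT]
    linear_combination r * hqp + (1 + X + C (1 / 2) * X ^ 2) * hpr
  refine ⟨(q * r).natDegree + ∑ k, ∑ i, (X * (N.adjugate k i * r)).natDegree, T, p₁ ^ 5, ?_⟩
  intro V _ _ L F W U ψ hψ
  have hX : ∀ Q : ℝ[X], L (aeval L Q ψ) = aeval L (X * Q) ψ := fun Q => by
    rw [map_mul, aeval_X, Module.End.mul_apply]
  -- Cramer's rule for the stages
  have hF : ∀ k, F k (aeval L (X * (q * r)) ψ) =
      ∑ i, W (aeval L (X * (N.adjugate k i * r)) ψ) := by
    intro k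
    have h1 : ∀ i, W (aeval L (X * (N.adjugate k i * r)) ψ) =
        ∑ j, F j (aeval L (N.adjugate k i * N i j * (X * r)) ψ) := by
      intro i
      have hdeg : (X * (N.adjugate k i * r)).natDegree ≤
          (q * r).natDegree + ∑ k, ∑ i, (X * (N.adjugate k i * r)).natDegree := by
        refine le_trans ?_ (Nat.le_add_left _ _)
        refine le_trans ?_ (Finset.single_le_sum (f := fun k => ∑ i,
          (X * (N.adjugate k i * r)).natDegree) (fun _ _ => Nat.zero_le _) (Finset.mem_univ k))
        exact Finset.single_le_sum (f := fun i => (X * (N.adjugate k i * r)).natDegree)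
          (fun _ _ => Nat.zero_le _) (Finset.mem_univ i)
      rw [← (hψ _ hdeg).1 i]
      have h2 : ∀ j, F j (aeval L (N.adjugate k i * N i j * (X * r)) ψ) =
          (if i = j then F j (aeval L (X * (N.adjugate k i * r)) ψ) else 0) +
          a i j * F j (L (aeval L (X * (N.adjugate k i * r)) ψ)) := by
        intro j
        have h3 : N.adjugate k i * N i j * (X * r) =
            (if i = j then X * (N.adjugate k i * r) else 0) +
              C (a i j) * (X * (X * (N.adjugate k i * r))) := by
          by_cases h : i = j <;> simp [hN, stageMatrix, h] <;> ring
        rw [h3, map_add, map_mul, aeval_C, LinearMap.add_apply, map_add, Module.End.mul_apply,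
          Module.algebraMap_end_apply, map_smul, smul_eq_mul, hX]
        by_cases h : i = j <;> simp [h]
      simp only [h2, Finset.sum_add_distrib, Finset.sum_ite_eq, Finset.mem_univ, if_true]
    simp only [h1]
    rw [Finset.sum_comm]
    have h4 : ∀ j, ∑ i, F j (aeval L (N.adjugate k i * N i j * (X * r)) ψ) =
        if k = j then F j (aeval L (X * (q * r)) ψ) else 0 := by
      intro j
      rw [← map_sum, ← LinearMap.sum_apply, ← map_sum, ← Finset.sum_mul, ← Matrix.mul_apply,
        Matrix.adjugate_mul, Matrix.smul_apply, Matrix.one_apply]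
      by_cases h : k = j
      · simp only [h, if_true, smul_eq_mul, mul_one]
        rw [show N.det * (X * r) = X * (q * r) by rw [← hq]; ring]
      · simp [h]
    simp only [h4, Finset.sum_ite_eq, Finset.mem_univ, if_true]
  have hU := (hψ (q * r) (Nat.le_add_right _ _)).2
  have hUW : U (aeval L (q * r) ψ) = W (aeval L (p * r) ψ) := by
    have h5 : p * r = q * r - ∑ k, C (b k) * ∑ i, X * (N.adjugate k i * r) := by
      rw [hp, stageSum, sub_mul, ← hN]
      congr 1
      rw [Finset.mul_sum, Finset.sum_mul]
      refine Finset.sum_congr rfl fun k _ => ?_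
      rw [← Finset.mul_sum, ← Finset.sum_mul]
      ring
    rw [hU, h5, map_sub, LinearMap.sub_apply, map_sub, map_sum, LinearMap.sum_apply, map_sum]
    congr 1
    refine Finset.sum_congr rfl fun k _ => ?_
    rw [hX, hF, map_mul, aeval_C, Module.End.mul_apply, Module.algebraMap_end_apply, map_smul,
      smul_eq_mul, map_sum, LinearMap.sum_apply, map_sum]
  rw [hpr, hqr] at hUW
  simp only [map_sub, map_add, map_mul, map_pow, map_one, aeval_C, aeval_X, LinearMap.sub_apply,
    LinearMap.add_apply, Module.End.mul_apply, Module.End.one_apply,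
    Module.algebraMap_end_apply, map_smul, smul_eq_mul, pow_two] at hUW ⊢
  linarith

end Elimination

/-! ### The duality estimate -/

/-- Fenchel's inequality for `y ↦ y (log y - 1)` and `exp`. -/
theorem mul_sub_exp_le_mul_log {y : ℝ} (hy : 0 ≤ y) (ψ : ℝ) :
    ψ * y - Real.exp ψ ≤ y * (Real.log y - 1) := by
  rcases hy.eq_or_lt with rfl | h
  · simp [Real.exp_nonneg]
  · have h1 := Real.add_one_le_exp (ψ - Real.log y)
    rw [Real.exp_sub, Real.exp_log h, le_div_iff₀ h] at h1
    nlinarith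

theorem exp_le_of_abs_le_one {δ : ℝ} (h : |δ| ≤ 1) :
    Real.exp δ ≤ 1 + δ + δ ^ 2 / 2 + |δ| ^ 3 := by
  have h1 := (abs_le.1 (Real.exp_bound h (n := 3) (by norm_num))).2
  have h2 : 0 ≤ |δ| ^ 3 := by positivity
  simp only [Finset.sum_range_succ, Finset.sum_range_zero, Nat.factorial] at h1
  norm_num at h1
  linarith

theorem SmoothPair.continuous_sum_abs (v : SmoothPair d) : Continuous fun x => ∑ l, |v l x| :=
  continuous_finsetSum _ fun l _ => (v l).continuous.abs

namespace SmoothDomain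
variable (D : SmoothDomain d)

theorem pairing_congr_right (u : SmoothPair d) {v v' : SmoothPair d}
    (H : ∀ l x, D.g x < 0 → v l x = v' l x) : D.pairing u v = D.pairing u v' :=
  D.int_congr fun x hx => by simp [H _ x hx]

/-- The `L¹` norm of a pair. -/
def normOne (v : SmoothPair d) : ℝ := ∫ x in D.inside, ∑ l, |v l x|

theorem normOne_nonneg (v : SmoothPair d) : 0 ≤ D.normOne v :=
  integral_nonneg fun _ => Finset.sum_nonneg fun _ _ => abs_nonneg _

theorem abs_pairing_le {f : SmoothPair d} {B : ℝ} (hf : ∀ l x, D.g x ≤ 0 → |f l x| ≤ B)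
    (v : SmoothPair d) : |D.pairing f v| ≤ B * D.normOne v := by
  rw [pairing_apply, int_apply, ← Real.norm_eq_abs, normOne, ← integral_const_mul]
  refine norm_integral_le_of_norm_le (D.integrableOn (continuous_const.mul
    (SmoothPair.continuous_sum_abs v))) ((ae_restrict_iff' D.measurableSet_inside).2
      (Eventually.of_forall fun x hx => ?_))
  rw [Real.norm_eq_abs, SmoothFun.sum_apply, Finset.mul_sum]
  refine (Finset.abs_sum_le_sum_abs _ _).trans (Finset.sum_le_sum fun l _ => ?_)
  rw [mul_apply, abs_mul]
  exact mul_le_mul_of_nonneg_right (hf l x (le_of_lt hx)) (abs_nonneg _)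

theorem exists_bound_pair (f : SmoothPair d) : ∃ C, 0 ≤ C ∧ ∀ l x, D.g x ≤ 0 → |f l x| ≤ C := by
  obtain ⟨C₀, hC₀, hB₀⟩ := D.exists_bound (f 0)
  obtain ⟨C₁, hC₁, hB₁⟩ := D.exists_bound (f 1)
  refine ⟨C₀ + C₁, by positivity, fun l x hx => ?_⟩
  fin_cases l
  · exact (hB₀ x hx).trans (by linarith)
  · exact (hB₁ x hx).trans (by linarith)

/-- The pairs satisfying the Neumann conditions, as a submodule. -/
def neumannSubmodule : Submodule ℝ (SmoothPair d) where
  carrier := {u | D.NeumannPair u}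
  add_mem' := fun {u v} (hu : D.NeumannPair u) (hv : D.NeumannPair v) l x hx => by
    rw [Pi.add_apply, dot_add_left, SmoothFun.add_apply, hu l x hx, hv l x hx, add_zero]
  zero_mem' := fun l x _ => by simp [dot]
  smul_mem' := fun c {u} (hu : D.NeumannPair u) l x hx => by
    rw [Pi.smul_apply, dot_smul_left, SmoothFun.smul_apply, hu l x hx, mul_zero]

theorem mem_neumannSubmodule {u : SmoothPair d} : u ∈ D.neumannSubmodule ↔ D.NeumannPair u :=
  Iff.rfl

open Polynomial in
theorem neumannPair_aeval {ρ μ τ : ℝ} {n : ℕ} {ψ : SmoothPair d}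
    (hψ : ∀ k ≤ n, D.NeumannPair ((diffOp ρ μ ^ k) ψ)) {Q : ℝ[X]} (hQ : Q.natDegree ≤ n) :
    D.NeumannPair (aeval (τ • diffOp ρ μ) Q ψ) := by
  rw [← mem_neumannSubmodule, aeval_eq_sum_range, LinearMap.sum_apply]
  refine Submodule.sum_mem _ fun k hk => ?_
  rw [LinearMap.smul_apply, _root_.smul_pow, LinearMap.smul_apply]
  exact Submodule.smul_mem _ _ (Submodule.smul_mem _ _ (hψ k (by
    have := Finset.mem_range.1 hk; omega)))

theorem tendsto_int_bump_sq_mul (f : SmoothFun d) :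
    Tendsto (fun n : ℕ => ∫ x in D.inside, bump ((n : ℝ) * D.g x) ^ 2 * f x) atTop (𝓝 0) := by
  have h0 : (0:ℝ) = ∫ x in D.inside, (0:ℝ) := by simp
  have hc : ∀ n : ℕ, Continuous fun x => bump ((n : ℝ) * D.g x) ^ 2 * f x := fun n => by
    have h1 := D.g.continuous
    exact ((bump.continuous.comp (by fun_prop)).pow 2).mul f.continuous
  refine (tendsto_integral_of_dominated_convergence (f := fun _ => 0) (fun x => |f x|)
    (fun n => (hc n).aestronglyMeasurable)
    (D.integrableOn f.continuous.abs) (fun n => Eventually.of_forall fun x => ?_)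
    ((ae_restrict_iff' D.measurableSet_inside).2 (Eventually.of_forall fun x hx => ?_))).trans (by rw [← h0])
  · rw [norm_mul, Real.norm_eq_abs, Real.norm_eq_abs, abs_of_nonneg (by positivity)]
    exact mul_le_of_le_one_left (abs_nonneg _) (pow_le_one₀ bump.nonneg bump.le_one)
  · refine tendsto_const_nhds.congr' ?_
    filter_upwards [D.eventually_two_le hx] with n hn
    rw [bump.zero_of_le_dist, zero_pow two_ne_zero, zero_mul]
    rw [dist_zero_right, Real.norm_eq_abs, abs_of_neg (by linarith)]
    exact le_trans (by norm_num [bump]) hn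

/-- The optimal second-order test pair `A U / U`, with `U = exp φ`, can be truncated near the
boundary without losing the positivity of the second-order coefficient. -/
theorem exists_truncate_pos {ρ μ : ℝ} (φ : SmoothPair d)
    (hQ : 0 < D.pairing (diffOp ρ μ φ) (diffOp ρ μ fun l => exp (φ l)) +
      D.int (∑ l, diffOp ρ μ (fun l => exp (φ l)) l ^ 2 * exp (-φ l))) :
    ∃ (ε : ℝ) (f : SmoothPair d), 0 < D.pairing (D.truncate ε f) (diffOp ρ μ fun l => exp (φ l)) -
      1 / 2 * D.int (∑ l, exp (φ l) * D.truncate ε f l ^ 2) +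
      1 / 2 * D.pairing (diffOp ρ μ φ) (diffOp ρ μ fun l => exp (φ l)) := by
  set Y := diffOp ρ μ fun l => exp (φ l) with hY
  set G : SmoothFun d := ∑ l, Y l ^ 2 * exp (-φ l) with hG
  obtain ⟨n, hn⟩ := ((D.tendsto_int_bump_sq_mul G).eventually (gt_mem_nhds hQ)).exists
  refine ⟨(n : ℝ)⁻¹, fun l => Y l * exp (-φ l), ?_⟩
  set f : SmoothPair d := fun l => Y l * exp (-φ l) with hf
  -- completing the square: `(1 - χ) - (1 - χ)² / 2 = (1 - χ²) / 2`
  have key : D.pairing (D.truncate (n : ℝ)⁻¹ f) Y -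
      1 / 2 * D.int (∑ l, exp (φ l) * D.truncate (n : ℝ)⁻¹ f l ^ 2) =
      1 / 2 * D.int G - 1 / 2 * ∫ x in D.inside, bump ((n : ℝ) * D.g x) ^ 2 * G x := by
    have h1 : D.pairing (D.truncate (n : ℝ)⁻¹ f) Y -
        1 / 2 * D.int (∑ l, exp (φ l) * D.truncate (n : ℝ)⁻¹ f l ^ 2) =
        D.int (∑ l, D.truncate (n : ℝ)⁻¹ f l * Y l -
          (1 / 2 : ℝ) • ∑ l, exp (φ l) * D.truncate (n : ℝ)⁻¹ f l ^ 2) := by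
      rw [map_sub, map_smul]; rfl
    have hc : Continuous fun x => bump ((n : ℝ) * D.g x) ^ 2 * G x := by
      have h1 := D.g.continuous
      exact ((bump.continuous.comp (by fun_prop)).pow 2).mul G.continuous
    rw [h1, ← integral_const_mul, int_apply, int_apply, ← integral_const_mul,
      ← integral_sub ((D.integrableOn G.continuous).const_mul _)
        ((D.integrableOn hc).const_mul _)]
    refine integral_congr_ae (Eventually.of_forall fun x => ?_)
    have e1 : ∀ l, Real.exp (φ l x) * Real.exp (-φ l x) = 1 := fun l => by
      rw [← Real.exp_add]; simp
    have e10 := e1 0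
    have e11 := e1 1
    simp only [Fin.sum_univ_two, hG, truncate, Pi.sub_apply, SmoothFun.sub_apply,
      SmoothFun.add_apply, SmoothFun.smul_apply, mul_apply, pow_apply, layer_apply, inv_inv, hf,
      exp_apply, SmoothFun.neg_apply]
    generalize bump ((n : ℝ) * D.g x) = c at *
    generalize Real.exp (φ 0 x) = p at *
    generalize Real.exp (φ 1 x) = q at *
    generalize Real.exp (-φ 0 x) = p' at *
    generalize Real.exp (-φ 1 x) = q' at *
    linear_combination (-(1 / 2) * (Y 0 x * (1 - c)) ^ 2 * p') * e10 +
      (-(1 / 2) * (Y 1 x * (1 - c)) ^ 2 * q') * e11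
  rw [key]
  linarith

end SmoothDomain

/-- Second-order expansion of the exponential at a perturbation `-e + σ⁵ η` with `e = O(σ⁶)`. -/
theorem exp_perturbation_le {σ e η E B : ℝ} (hσ : 0 < σ) (hσ1 : σ ≤ 1)
    (he : |e| ≤ E * σ ^ 6) (hη : |η| ≤ B) (hsmall : (E + B) * σ ≤ 1) (hE : 0 ≤ E) (hB : 0 ≤ B) :
    Real.exp (-e + σ ^ 5 * η) ≤ 1 + (-e + σ ^ 5 * η) + σ ^ 10 / 2 * η ^ 2 +
      (B * E + E ^ 2 + (E + B) ^ 3) * σ ^ 11 := by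
  have hpow : ∀ {a b : ℕ}, a ≤ b → σ ^ b ≤ σ ^ a := fun h => pow_le_pow_of_le_one hσ.le hσ1 h
  have h5 : 0 < σ ^ 5 := by positivity
  have hδ : |-e + σ ^ 5 * η| ≤ (E + B) * σ ^ 5 := by
    refine (abs_add_le _ _).trans ?_
    rw [abs_neg, abs_mul, abs_of_pos h5]
    have h1 := mul_le_mul_of_nonneg_left (hpow (show 5 ≤ 6 by norm_num)) hE
    have h2 := mul_le_mul_of_nonneg_left hη h5.le
    linarith
  have hδ1 : |-e + σ ^ 5 * η| ≤ 1 := by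
    refine hδ.trans (le_trans ?_ hsmall)
    have := hpow (show 1 ≤ 5 by norm_num)
    rw [pow_one] at this
    exact mul_le_mul_of_nonneg_left this (by positivity)
  have hcube : |-e + σ ^ 5 * η| ^ 3 ≤ (E + B) ^ 3 * σ ^ 11 := by
    calc |-e + σ ^ 5 * η| ^ 3 ≤ ((E + B) * σ ^ 5) ^ 3 := pow_le_pow_left₀ (abs_nonneg _) hδ 3
      _ = (E + B) ^ 3 * σ ^ 15 := by ring
      _ ≤ _ := mul_le_mul_of_nonneg_left (hpow (by norm_num)) (by positivity)
  have hcross : -(e * (σ ^ 5 * η)) ≤ B * E * σ ^ 11 := by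
    refine (neg_le_abs _).trans ?_
    rw [abs_mul, abs_mul, abs_of_pos h5]
    calc |e| * (σ ^ 5 * |η|) ≤ (E * σ ^ 6) * (σ ^ 5 * B) :=
          mul_le_mul he (mul_le_mul_of_nonneg_left hη h5.le) (by positivity) (by positivity)
      _ = _ := by ring
  have hsq : e ^ 2 ≤ E ^ 2 * σ ^ 11 := by
    rw [← sq_abs]
    calc |e| ^ 2 ≤ (E * σ ^ 6) ^ 2 := pow_le_pow_left₀ (abs_nonneg _) he 2
      _ = E ^ 2 * σ ^ 12 := by ring
      _ ≤ _ := mul_le_mul_of_nonneg_left (hpow (by norm_num)) (by positivity)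
  have hexp := exp_le_of_abs_le_one hδ1
  have h10 : (σ ^ 5 * η) ^ 2 = σ ^ 10 * η ^ 2 := by ring
  nlinarith [sq_nonneg e]

namespace SmoothDomain
variable (D : SmoothDomain d)

theorem int_exp_perturbation_le {φ e η Ψ : SmoothPair d} {σ E B : ℝ} (hσ : 0 < σ) (hσ1 : σ ≤ 1)
    (he : ∀ l x, D.g x ≤ 0 → |e l x| ≤ E * σ ^ 6) (hη : ∀ l x, D.g x ≤ 0 → |η l x| ≤ B)
    (hsmall : (E + B) * σ ≤ 1) (hE : 0 ≤ E) (hB : 0 ≤ B) (hΨ : Ψ = φ - e + σ ^ 5 • η) :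
    D.int (∑ l, exp (Ψ l)) ≤ D.int (∑ l, exp (φ l)) + D.pairing (Ψ - φ) (fun l => exp (φ l)) +
      σ ^ 10 / 2 * D.int (∑ l, exp (φ l) * η l ^ 2) +
      (B * E + E ^ 2 + (E + B) ^ 3) * σ ^ 11 * D.int (∑ l, exp (φ l)) := by
  rw [pairing_apply, ← smul_eq_mul (σ ^ 10 / 2), ← map_smul, ← smul_eq_mul (_ * σ ^ 11),
    ← map_smul, ← map_add, ← map_add, ← map_add]
  refine D.int_mono fun x hx => ?_
  simp only [SmoothFun.sum_apply, SmoothFun.add_apply, SmoothFun.smul_apply, mul_apply, exp_apply,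
    pow_apply, Finset.mul_sum, ← Finset.sum_add_distrib]
  refine Finset.sum_le_sum fun l _ => ?_
  have h1 := exp_perturbation_le hσ hσ1 (he l x (le_of_lt hx)) (hη l x (le_of_lt hx)) hsmall hE hB
  have h2 : Ψ l x = φ l x + (-e l x + σ ^ 5 * η l x) := by
    rw [hΨ]
    simp only [Pi.add_apply, Pi.sub_apply, Pi.smul_apply, SmoothFun.add_apply,
      SmoothFun.sub_apply, SmoothFun.smul_apply]
    ring
  rw [Pi.sub_apply, SmoothFun.sub_apply, h2, Real.exp_add]
  refine (mul_le_mul_of_nonneg_left h1 (Real.exp_pos _).le).trans (le_of_eq ?_)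
  ring

/-- Test pairs for the duality estimate. They approximate `φ + τ A U / U`, where `U = exp φ` and
`τ = σ⁵`, with a boundary layer of width `σ²`: this makes the approximation of `φ` better than
`τ`, while each further power of `τ A` still gains a factor `σ`. The value of the dual functional
exceeds the first-order expansion of the entropy by a multiple of `τ²`. -/
theorem exists_test_family {ρ μ : ℝ} (hρ : ρ ≠ 0) {φ : SmoothPair d} (hφ : D.NeumannPair φ)
    (hQ : 0 < D.pairing (diffOp ρ μ φ) (diffOp ρ μ fun l => exp (φ l)) +
      D.int (∑ l, diffOp ρ μ (fun l => exp (φ l)) l ^ 2 * exp (-φ l))) (n : ℕ) :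
    ∃ (κ C : ℝ) (Bd : ℕ → ℝ) (σ₁ : ℝ), 0 < κ ∧ 0 < σ₁ ∧ σ₁ ≤ 1 ∧ ∀ σ, 0 < σ → σ ≤ σ₁ →
      ∃ Ψ : SmoothPair d, (∀ k ≤ n, D.NeumannPair ((diffOp ρ μ ^ k) Ψ)) ∧
        (∀ k, 2 ≤ k → ∀ l x, D.g x ≤ 0 →
          |(((σ ^ 5) • diffOp ρ μ) ^ k) Ψ l x| ≤ Bd k * σ ^ (k + 6)) ∧
        D.pairing φ (fun l => exp (φ l)) - D.int (∑ l, exp (φ l)) +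
          σ ^ 5 * D.pairing φ (diffOp ρ μ fun l => exp (φ l)) + σ ^ 10 * κ - C * σ ^ 11 ≤
        D.pairing Ψ (fun l => exp (φ l)) +
          σ ^ 5 * D.pairing Ψ (diffOp ρ μ fun l => exp (φ l)) +
          1 / 2 * σ ^ 10 * D.pairing (diffOp ρ μ Ψ) (diffOp ρ μ fun l => exp (φ l)) -
          D.int (∑ l, exp (Ψ l)) := by
  obtain ⟨ε, f, hκ⟩ := D.exists_truncate_pos φ hQ
  set η := D.truncate ε f with hη
  set U : SmoothPair d := fun l => exp (φ l) with hU
  set Y := diffOp ρ μ U with hY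
  obtain ⟨Φ, E, hE, hΦ⟩ := D.exists_approximation hρ μ hφ n
  choose Bφ hBφ0 hBφ using fun k => D.exists_bound_pair ((diffOp ρ μ ^ k) φ)
  choose Bη hBη0 hBη using fun k => D.exists_bound_pair ((diffOp ρ μ ^ k) η)
  refine ⟨_, (Bη 0 * E 0 + E 0 ^ 2 + (E 0 + Bη 0) ^ 3) * D.int (∑ l, exp (φ l)) + E 0 * D.normOne Y + E 1 * D.normOne Y +
    Bη 1 * D.normOne Y, fun k => Bφ k + E k + Bη k, min 1 (1 / (E 0 + Bη 0 + 1)), hκ, ?_,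
    min_le_left _ _, fun σ hσ hle => ?_⟩
  · have := hE 0; have := hBη0 0
    positivity
  have hσ1 : σ ≤ 1 := hle.trans (min_le_left _ _)
  have hsmall : (E 0 + Bη 0) * σ ≤ 1 := by
    have h1 := hle.trans (min_le_right _ _)
    have := hE 0; have := hBη0 0
    rw [le_div_iff₀ (by positivity)] at h1
    nlinarith
  have hpow : ∀ {a b : ℕ}, a ≤ b → σ ^ b ≤ σ ^ a := fun h => pow_le_pow_of_le_one hσ.le hσ1 h
  obtain ⟨hΦN, hΦE⟩ := hΦ (σ ^ 2) (by positivity) (pow_le_one₀ hσ.le hσ1)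
  set e := φ - Φ (σ ^ 2) with he
  set Ψ := Φ (σ ^ 2) + σ ^ 5 • η with hΨ
  have hΨe : Ψ = φ - e + σ ^ 5 • η := by rw [hΨ, he, sub_sub_cancel]
  have he0 : ∀ l x, D.g x ≤ 0 → |e l x| ≤ E 0 * σ ^ 6 := fun l x hx => by
    have := hΦE 0 l x hx
    simp only [pow_zero, Module.End.one_apply, mul_zero, mul_one] at this
    exact this.trans (le_of_eq (by ring))
  have he1 : ∀ l x, D.g x ≤ 0 → |diffOp ρ μ e l x| ≤ E 1 * σ := fun l x hx => by
    have := hΦE 1 l x hx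
    simp only [pow_one] at this
    refine this.trans (mul_le_mul_of_nonneg_left ?_ (hE 1))
    have h2 : (σ ^ 2) ^ 3 * (σ ^ 2)⁻¹ ^ (2 * 1) = σ ^ 2 := by
      rw [mul_one]
      field_simp
    rw [h2]
    exact (hpow (show 1 ≤ 2 by norm_num)).trans (pow_one σ).le
  have hη0 : ∀ l x, D.g x ≤ 0 → |η l x| ≤ Bη 0 := hBη 0
  refine ⟨Ψ, fun k hk => ?_, fun k hk l x hx => ?_, ?_⟩
  · rw [← mem_neumannSubmodule, hΨ, map_add, map_smul]
    exact Submodule.add_mem _ (hΦN k hk)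
      (Submodule.smul_mem _ _ (D.neumannPair_truncate ρ μ ε f k))
  · rw [_root_.smul_pow, LinearMap.smul_apply, hΨe, map_add, map_sub, map_smul]
    simp only [Pi.smul_apply, Pi.add_apply, Pi.sub_apply, SmoothFun.smul_apply,
      SmoothFun.add_apply, SmoothFun.sub_apply]
    rw [abs_mul, abs_of_pos (by positivity), ← pow_mul]
    have h1 := hBφ k l x hx
    have h2 := hΦE k l x hx
    have h3 := hBη k l x hx
    have h4 : σ ^ (5 * k) * ((σ ^ 2) ^ 3 * (σ ^ 2)⁻¹ ^ (2 * k)) = σ ^ (k + 6) := by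
      rw [inv_pow, ← pow_mul, ← pow_mul, show 5 * k = k + 2 * (2 * k) by ring, pow_add, pow_add]
      field_simp
    have h5 : σ ^ (5 * k) ≤ σ ^ (k + 6) := hpow (by omega)
    have h6 : σ ^ 5 ≤ 1 := pow_le_one₀ hσ.le hσ1
    calc σ ^ (5 * k) * |_| ≤ σ ^ (5 * k) *
          (Bφ k + E k * ((σ ^ 2) ^ 3 * (σ ^ 2)⁻¹ ^ (2 * k)) + σ ^ 5 * Bη k) := by
          refine mul_le_mul_of_nonneg_left ?_ (by positivity)
          refine (abs_add_le _ _).trans (add_le_add ((abs_sub _ _).trans (add_le_add h1 h2)) ?_)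
          rw [abs_mul, abs_of_pos (by positivity)]
          exact mul_le_mul_of_nonneg_left h3 (by positivity)
      _ = σ ^ (5 * k) * Bφ k + E k * σ ^ (k + 6) + σ ^ (5 * k) * (σ ^ 5 * Bη k) := by
          rw [← h4]; ring
      _ ≤ σ ^ (k + 6) * Bφ k + E k * σ ^ (k + 6) + σ ^ (k + 6) * (1 * Bη k) := by
          have := hBφ0 k; have := hBη0 k
          gcongr
      _ = _ := by ring
  · have hexp := D.int_exp_perturbation_le hσ hσ1 he0 hη0 hsmall (hE 0) (hBη0 0) hΨe
    have b0 := D.abs_pairing_le he0 Y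
    have b1 := D.abs_pairing_le he1 Y
    have b2 := D.abs_pairing_le (f := diffOp ρ μ η) (B := Bη 1)
      (by simpa only [pow_one] using hBη 1) Y
    have hY0 := D.normOne_nonneg Y
    have p1 : D.pairing Ψ Y = D.pairing φ Y - D.pairing e Y + σ ^ 5 * D.pairing η Y := by
      rw [hΨe]; simp
    have p2 : D.pairing (diffOp ρ μ Ψ) Y = D.pairing (diffOp ρ μ φ) Y -
        D.pairing (diffOp ρ μ e) Y + σ ^ 5 * D.pairing (diffOp ρ μ η) Y := by
      rw [hΨe]; simp
    have p3 : D.pairing (Ψ - φ) U = D.pairing Ψ U - D.pairing φ U := by simp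
    rw [p3] at hexp
    rw [p1, p2]
    have c0 : σ ^ 5 * D.pairing e Y ≤ E 0 * D.normOne Y * σ ^ 11 := by
      calc σ ^ 5 * D.pairing e Y ≤ σ ^ 5 * (E 0 * σ ^ 6 * D.normOne Y) :=
            mul_le_mul_of_nonneg_left ((le_abs_self _).trans b0) (by positivity)
        _ = _ := by ring
    have hE1 := hE 1
    have hB1 := hBη0 1
    have c1 : 1 / 2 * σ ^ 10 * D.pairing (diffOp ρ μ e) Y ≤ E 1 * D.normOne Y * σ ^ 11 := by
      calc 1 / 2 * σ ^ 10 * D.pairing (diffOp ρ μ e) Y ≤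
            1 / 2 * σ ^ 10 * (E 1 * σ * D.normOne Y) :=
            mul_le_mul_of_nonneg_left ((le_abs_self _).trans b1) (by positivity)
        _ = 1 / 2 * (E 1 * D.normOne Y * σ ^ 11) := by ring
        _ ≤ _ := by
          have : 0 ≤ E 1 * D.normOne Y * σ ^ 11 := by positivity
          linarith
    have c2 : -(1 / 2 * σ ^ 10 * (σ ^ 5 * D.pairing (diffOp ρ μ η) Y)) ≤
        Bη 1 * D.normOne Y * σ ^ 11 := by
      have h1 : -D.pairing (diffOp ρ μ η) Y ≤ Bη 1 * D.normOne Y := (neg_le_abs _).trans b2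
      have h2 : σ ^ 15 ≤ σ ^ 11 := hpow (by norm_num)
      have h3 : 0 ≤ Bη 1 * D.normOne Y := by positivity
      calc -(1 / 2 * σ ^ 10 * (σ ^ 5 * D.pairing (diffOp ρ μ η) Y)) =
            1 / 2 * σ ^ 15 * -D.pairing (diffOp ρ μ η) Y := by ring
        _ ≤ 1 / 2 * σ ^ 15 * (Bη 1 * D.normOne Y) :=
            mul_le_mul_of_nonneg_left h1 (by positivity)
        _ ≤ 1 * σ ^ 11 * (Bη 1 * D.normOne Y) := by gcongr; norm_num
        _ = _ := by ring
    have hU' : D.pairing φ (fun l => exp (φ l)) = D.pairing φ U := rfl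
    linarith

end SmoothDomain

namespace SmoothDomain
variable (D : SmoothDomain d)

/-- The stage value `w + τ ∑ⱼ aᵢⱼ Kⱼ` as a smooth pair. -/
def stagePair {s : ℕ} (a : Fin s → Fin s → ℝ) (τ : ℝ) (w : SmoothPair d)
    (K : Fin s → SmoothPair d) (i : Fin s) : SmoothPair d :=
  w + τ • ∑ j, a i j • K j

/-- `U` arises from `w` by one Runge-Kutta step of size `τ` with increments `K`. -/
structure IsStep {s : ℕ} (ρ μ : ℝ) (a : Fin s → Fin s → ℝ) (b : Fin s → ℝ) (τ : ℝ)
    (w U : SmoothPair d) (K : Fin s → SmoothPair d) : Prop where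
  neumann : ∀ i, D.NeumannPair (stagePair a τ w K i)
  increment : ∀ i l x, D.g x < 0 → K i l x = (-diffOp ρ μ (stagePair a τ w K i)) l x
  step : ∀ l x, D.g x < 0 → U l x = (w + τ • ∑ i, b i • K i) l x

section Step
variable {D}
variable {s : ℕ} {ρ μ τ : ℝ} {a : Fin s → Fin s → ℝ} {b : Fin s → ℝ}
  {w U : SmoothPair d} {K : Fin s → SmoothPair d}

theorem IsStep.pairing_increment (H : D.IsStep ρ μ a b τ w U K) {θ : SmoothPair d}
    (hθ : D.NeumannPair θ) (i : Fin s) :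
    D.pairing θ (K i) = -D.pairing (diffOp ρ μ θ) (stagePair a τ w K i) := by
  rw [D.pairing_congr_right θ (H.increment i), map_neg, D.pairing_diffOp hθ (H.neumann i)]

theorem IsStep.pairing_stage (H : D.IsStep ρ μ a b τ w U K) {θ : SmoothPair d}
    (hθ : D.NeumannPair θ) (i : Fin s) :
    D.pairing θ (stagePair a τ w K i) +
      ∑ j, a i j * D.pairing ((τ • diffOp ρ μ) θ) (stagePair a τ w K j) = D.pairing θ w := by
  conv_lhs => rw [stagePair]
  simp only [map_add, map_smul, map_sum, smul_eq_mul, LinearMap.smul_apply,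
    H.pairing_increment hθ, Finset.mul_sum]
  rw [add_assoc, ← Finset.sum_add_distrib, Finset.sum_eq_zero, add_zero]
  intro j _
  ring

theorem IsStep.pairing_step (H : D.IsStep ρ μ a b τ w U K) {θ : SmoothPair d}
    (hθ : D.NeumannPair θ) :
    D.pairing θ U = D.pairing θ w -
      ∑ j, b j * D.pairing ((τ • diffOp ρ μ) θ) (stagePair a τ w K j) := by
  rw [D.pairing_congr_right θ H.step]
  simp only [map_add, map_smul, map_sum, smul_eq_mul, LinearMap.smul_apply,
    H.pairing_increment hθ, Finset.mul_sum, sub_eq_add_neg, ← Finset.sum_neg_distrib]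
  congr 1
  exact Finset.sum_congr rfl fun j _ => by ring

/-- A step conserves the total mass. -/
theorem IsStep.normOne_eq (H : D.IsStep ρ μ a b τ w U K) (hw : ∀ l x, D.g x < 0 → 0 ≤ w l x) :
    D.normOne w = D.int (∑ l, U l) := by
  have h1 : D.NeumannPair (1 : SmoothPair d) := fun l x _ => by simp [dot]
  have hA : diffOp ρ μ (1 : SmoothPair d) = 0 := by
    funext l
    simp [diffOp_apply, lap_def]
  have h2 := H.pairing_step h1
  simp only [LinearMap.smul_apply, hA, smul_zero, map_zero, LinearMap.zero_apply, mul_zero,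
    Finset.sum_const_zero, sub_zero] at h2
  simp only [pairing_apply, Pi.one_apply, one_mul] at h2
  rw [h2, normOne, int_apply]
  refine setIntegral_congr_fun D.measurableSet_inside fun x hx => ?_
  simp only [SmoothFun.sum_apply]
  exact Finset.sum_congr rfl fun l _ => abs_of_nonneg (hw l x hx)

end Step

open Polynomial in
theorem abs_aeval_le {L : Module.End ℝ (SmoothPair d)} {ψ : SmoothPair d} {Bd : ℕ → ℝ} {σ : ℝ}
    (hσ : 0 < σ) (hσ1 : σ ≤ 1)
    (h : ∀ k, 2 ≤ k → ∀ l x, D.g x ≤ 0 → |(L ^ k) ψ l x| ≤ Bd k * σ ^ (k + 6))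
    (P : ℝ[X]) {j : ℕ} (hj : 2 ≤ j) (l : Fin 2) (x) (hx : D.g x ≤ 0) :
    |aeval L (X ^ j * P) ψ l x| ≤
      (∑ i ∈ Finset.range (P.natDegree + 1), |P.coeff i| * |Bd (j + i)|) * σ ^ (j + 6) := by
  rw [map_mul, map_pow, aeval_X, aeval_eq_sum_range, Finset.mul_sum, LinearMap.sum_apply,
    Finset.sum_apply, SmoothFun.sum_apply, Finset.sum_mul]
  refine (Finset.abs_sum_le_sum_abs _ _).trans (Finset.sum_le_sum fun i _ => ?_)
  rw [mul_smul_comm, ← pow_add, LinearMap.smul_apply, Pi.smul_apply, SmoothFun.smul_apply,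
    abs_mul, mul_assoc]
  refine mul_le_mul_of_nonneg_left ?_ (abs_nonneg _)
  refine (h (j + i) (by omega) l x hx).trans ?_
  exact mul_le_mul (le_abs_self _) (pow_le_pow_of_le_one hσ.le hσ1 (by omega)) (by positivity)
    (abs_nonneg _)

theorem pairing_sub_int_exp_le (ψ : SmoothPair d) {w : SmoothPair d}
    (hw : ∀ l x, D.g x < 0 → 0 ≤ w l x) :
    D.pairing ψ w - D.int (∑ l, exp (ψ l)) ≤
      ∫ x in D.inside, ∑ l, w l x * (Real.log (w l x) - 1) := by
  rw [pairing_apply, ← map_sub]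
  refine setIntegral_mono_on (D.integrableOn (SmoothFun.continuous _)) (D.integrableOn ?_)
    D.measurableSet_inside fun x hx => ?_
  · refine continuous_finsetSum _ fun l _ => ?_
    simp only [mul_sub, mul_one]
    exact (Real.continuous_mul_log.comp (w l).continuous).sub (w l).continuous
  · rw [SmoothFun.sub_apply, SmoothFun.sum_apply, SmoothFun.sum_apply, ← Finset.sum_sub_distrib]
    exact Finset.sum_le_sum fun l _ => mul_sub_exp_le_mul_log (hw l x hx) _

open Polynomial in
/-- Entropy decay for one step, with the new value written as `U = exp φ`. -/
theorem exists_step_entropy_le (hconv : Convex ℝ D.inside) {ρ μ : ℝ} (hρ : 0 < ρ) (hμ : 0 < μ)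
    {s : ℕ} {a : Fin s → Fin s → ℝ} {b : Fin s → ℝ} (hb : ∑ i, b i = 1) (hC : cRK a b = 1)
    {φ : SmoothPair d} (hφ : D.NeumannPair φ)
    (hne : ¬ ∀ l x, D.g x < 0 → diffOp ρ μ (fun l => exp (φ l)) l x = 0) :
    ∃ τ₀ : ℝ, 0 < τ₀ ∧ ∀ τ, 0 < τ → τ < τ₀ → ∀ w : SmoothPair d,
      (∀ l x, D.g x < 0 → 0 ≤ w l x) → ∀ K,
      D.IsStep ρ μ a b τ w (fun l => exp (φ l)) K →
        D.pairing φ (fun l => exp (φ l)) - D.int (∑ l, exp (φ l)) +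
          τ * D.pairing φ (diffOp ρ μ fun l => exp (φ l)) ≤
        ∫ x in D.inside, ∑ l, w l x * (Real.log (w l x) - 1) := by
  obtain ⟨m, T, R, helim⟩ := exists_elimination hb hC
  obtain ⟨κ, C, Bd, σ₁, hκ, hσ₁, hσ₁1, hfam⟩ := D.exists_test_family hρ.ne' hφ
    (D.second_derivative_pos hconv hρ hμ hφ hne) (m + T.natDegree + 3)
  set U : SmoothPair d := fun l => exp (φ l) with hU
  have hUN : D.NeumannPair U := fun l => (hφ l).exp
  set Y := diffOp ρ μ U with hY
  set CT := ∑ i ∈ Finset.range (T.natDegree + 1), |T.coeff i| * |Bd (2 + i)| with hCT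
  set CR := ∑ i ∈ Finset.range (R.natDegree + 1), |R.coeff i| * |Bd (5 + i)| with hCR
  have hCT0 : 0 ≤ CT := Finset.sum_nonneg fun i _ => by positivity
  have hCR0 : 0 ≤ CR := Finset.sum_nonneg fun i _ => by positivity
  have hmass : 0 ≤ D.int (∑ l, U l) := D.int_nonneg fun x _ => by
    rw [SmoothFun.sum_apply]
    exact Finset.sum_nonneg fun l _ => (Real.exp_pos _).le
  have hY0 := D.normOne_nonneg Y
  set Ctot := |C| + CT * D.normOne Y + CR * D.int (∑ l, U l) with hCtot
  have hCtot0 : 0 ≤ Ctot := by positivity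
  set σ₂ := min σ₁ (κ / (Ctot + 1)) with hσ₂
  have hσ₂0 : 0 < σ₂ := lt_min hσ₁ (by positivity)
  refine ⟨σ₂ ^ 5, by positivity, fun τ hτ hτlt w hw K H => ?_⟩
  obtain ⟨σ, hσ, rfl⟩ : ∃ σ : ℝ, 0 < σ ∧ σ ^ 5 = τ :=
    ⟨τ ^ ((5 : ℕ) : ℝ)⁻¹, Real.rpow_pos_of_pos hτ _,
      Real.rpow_inv_natCast_pow hτ.le (by norm_num)⟩
  have hσlt : σ < σ₂ := lt_of_pow_lt_pow_left₀ 5 hσ₂0.le hτlt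
  have hσ1 : σ ≤ 1 := (hσlt.le.trans (min_le_left _ _)).trans hσ₁1
  have hσκ : Ctot * σ ≤ κ := by
    have h1 := hσlt.le.trans (min_le_right _ _)
    rw [le_div_iff₀ (by positivity)] at h1
    nlinarith
  obtain ⟨Ψ, hΨN, hΨB, hΨ⟩ := hfam σ hσ (hσlt.le.trans (min_le_left _ _))
  set L := σ ^ 5 • diffOp ρ μ with hL
  have hexpand := helim (SmoothPair d) L
    (fun i => D.pairing.flip (stagePair a (σ ^ 5) w K i)) (D.pairing.flip w) (D.pairing.flip U) Ψ
    (fun Q hQ => by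
      have hN := D.neumannPair_aeval (τ := σ ^ 5) (fun k hk => hΨN k hk)
        (Q := Q) (hQ.trans (by omega))
      exact ⟨fun i => H.pairing_stage hN i, H.pairing_step hN⟩)
  simp only [LinearMap.flip_apply] at hexpand
  have hmove : ∀ {θ : SmoothPair d}, D.NeumannPair θ →
      D.pairing (L θ) U = σ ^ 5 * D.pairing θ Y := fun hθ => by
    rw [hL, LinearMap.smul_apply, map_smul, LinearMap.smul_apply, smul_eq_mul,
      D.pairing_diffOp hθ hUN]
  have hN0 : D.NeumannPair Ψ := hΨN 0 (Nat.zero_le _)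
  have hN1 : D.NeumannPair (L Ψ) := by
    rw [← mem_neumannSubmodule, hL, LinearMap.smul_apply]
    exact Submodule.smul_mem _ _ (hΨN 1 (by omega))
  have e1 := hmove hN0
  have e2 : D.pairing (L (L Ψ)) U = σ ^ 10 * D.pairing (diffOp ρ μ Ψ) Y := by
    rw [hmove hN1, hL, LinearMap.smul_apply, map_smul, LinearMap.smul_apply, smul_eq_mul]
    ring
  have e3 : D.pairing (aeval L (X ^ 3 * T) Ψ) U =
      σ ^ 5 * D.pairing (aeval L (X ^ 2 * T) Ψ) Y := by
    have hNT : D.NeumannPair (aeval L (X ^ 2 * T) Ψ) := by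
      refine D.neumannPair_aeval hΨN (natDegree_mul_le.trans ?_)
      rw [natDegree_X_pow]
      omega
    rw [← hmove hNT, show (X ^ 3 * T : ℝ[X]) = X * (X ^ 2 * T) by ring, map_mul, aeval_X,
      Module.End.mul_apply]
  have b3 := D.abs_pairing_le (D.abs_aeval_le hσ hσ1 hΨB T (j := 2) le_rfl) Y
  have b4 := D.abs_pairing_le (D.abs_aeval_le hσ hσ1 hΨB R (j := 5) (by norm_num)) w
  rw [H.normOne_eq hw] at b4
  rw [e1, e2, e3] at hexpand
  have hpow : ∀ {a b : ℕ}, a ≤ b → σ ^ b ≤ σ ^ a := fun h => pow_le_pow_of_le_one hσ.le hσ1 h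
  have c3 : -(σ ^ 5 * D.pairing (aeval L (X ^ 2 * T) Ψ) Y) ≤ CT * D.normOne Y * σ ^ 11 := by
    calc -(σ ^ 5 * D.pairing (aeval L (X ^ 2 * T) Ψ) Y) =
          σ ^ 5 * -D.pairing (aeval L (X ^ 2 * T) Ψ) Y := by ring
      _ ≤ σ ^ 5 * (CT * σ ^ (2 + 6) * D.normOne Y) :=
          mul_le_mul_of_nonneg_left ((neg_le_abs _).trans b3) (by positivity)
      _ = CT * D.normOne Y * σ ^ 13 := by ring
      _ ≤ _ := mul_le_mul_of_nonneg_left (hpow (by norm_num)) (by positivity)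
  have c4 : -D.pairing (aeval L (X ^ 5 * R) Ψ) w ≤ CR * D.int (∑ l, U l) * σ ^ 11 := by
    refine (neg_le_abs _).trans (b4.trans (le_of_eq ?_))
    ring
  have c5 : C * σ ^ 11 ≤ |C| * σ ^ 11 := mul_le_mul_of_nonneg_right (le_abs_self _) (by positivity)
  have c6 : Ctot * σ ^ 11 ≤ σ ^ 10 * κ := by
    calc Ctot * σ ^ 11 = σ ^ 10 * (Ctot * σ) := by ring
      _ ≤ _ := mul_le_mul_of_nonneg_left hσκ (by positivity)
  rw [hCtot] at c6
  have hdual := D.pairing_sub_int_exp_le Ψ hw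
  linarith

/-- A smooth function which is positive on the closed domain is an exponential there. -/
theorem exists_log {u : SmoothFun d} (hu : ∀ x, D.g x ≤ 0 → 0 < u x) :
    ∃ φ : SmoothFun d, ∀ x, D.g x ≤ 0 → exp φ x = u x := by
  obtain ⟨m, hm, hle⟩ := D.isCompact_closed.exists_forall_le' (a := 0) u.continuous.continuousOn hu
  obtain ⟨G, hG, hGeq⟩ := exists_contDiff_extension (F := Real.log)
    (fun t ht => Real.contDiffAt_log.2 ht.ne') hm
  refine ⟨comp G hG u, fun x hx => ?_⟩
  rw [exp_apply, comp_apply, hGeq _ (hle x hx), Real.exp_log (hu x hx)]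

theorem eventuallyEq_of_eqOn {f h : SmoothFun d} (H : ∀ x, D.g x ≤ 0 → f x = h x) {x}
    (hx : D.g x < 0) : f =ᶠ[𝓝 x] h :=
  Filter.mem_of_superset (D.isOpen_inside.mem_nhds hx) fun y hy => H y (le_of_lt hy)

theorem dot_eq_of_eqOn {f h : SmoothFun d} (H : ∀ x, D.g x ≤ 0 → f x = h x) (k : SmoothFun d) :
    ∀ x, D.g x ≤ 0 → dot f k x = dot h k x := by
  have h1 : EqOn (dot f k) (dot h k) D.inside := fun x hx =>
    (dot_congr_left (D.eventuallyEq_of_eqOn H hx) k).self_of_nhds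
  have h2 := h1.closure (dot f k).continuous (dot h k).continuous
  rw [D.closure_inside] at h2
  exact fun x hx => h2 hx

end SmoothDomain

/-! ### Transfer to the statement -/

theorem IsDefiningFunction.isOuterUnitNormal {Ω : Set (EuclideanSpace ℝ (Fin d))}
    {g : EuclideanSpace ℝ (Fin d) → ℝ} (hg : IsDefiningFunction Ω g) {x} (hx : x ∈ frontier Ω) :
    IsOuterUnitNormal Ω x (‖gradient g x‖⁻¹ • gradient g x) :=
  ⟨hx, g, hg, rfl⟩

theorem IsDefiningFunction.exists_smoothDomain {Ω : Set (EuclideanSpace ℝ (Fin d))}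
    {g : EuclideanSpace ℝ (Fin d) → ℝ} (hg : IsDefiningFunction Ω g) (hΩ : Bornology.IsBounded Ω) :
    ∃ D : SmoothDomain d, D.inside = Ω ∧ (D.g : EuclideanSpace ℝ (Fin d) → ℝ) = g := by
  refine ⟨⟨SmoothFun.mk g hg.smooth, ?_, fun x hx => ?_⟩, hg.eq_setOf_neg.symm, rfl⟩
  · rw [hg.eq_setOf_neg] at hΩ
    exact hΩ
  · rw [← norm_gradient_sq]
    exact pow_ne_zero 2 (norm_ne_zero_iff.2 (hg.gradient_ne_zero x hx))

theorem systemOp_eq (ρ μ : ℝ) (u : SmoothPair d) (l : Fin 2) (x) :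
    systemOp ρ ρ μ (fun l => (u l : EuclideanSpace ℝ (Fin d) → ℝ)) l x = diffOp ρ μ u l x := by
  fin_cases l <;> simp [systemOp, diffOp_apply, laplacian_eq]

namespace SmoothDomain
variable (D : SmoothDomain d)

theorem neumannPair_of_isSmoothNeumann (hg : IsDefiningFunction D.inside D.g) {u : SmoothPair d}
    (hu : IsSmoothNeumann D.inside fun l => (u l : EuclideanSpace ℝ (Fin d) → ℝ)) :
    D.NeumannPair u := by
  intro l x hx
  have hfr : x ∈ frontier D.inside := by rw [D.frontier_inside]; exact hx
  have h1 := hu.neumann l x _ (hg.isOuterUnitNormal hfr)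
  rw [inner_smul_right, inner_gradient] at h1
  exact (mul_eq_zero.1 h1).resolve_left
    (inv_ne_zero (norm_ne_zero_iff.2 (hg.gradient_ne_zero x hx)))

theorem entropy_exp {φ u : SmoothPair d} (hφ : ∀ l x, D.g x ≤ 0 → exp (φ l) x = u l x) :
    entropy D.inside (fun l => (u l : EuclideanSpace ℝ (Fin d) → ℝ)) =
      D.pairing φ (fun l => exp (φ l)) - D.int (∑ l, exp (φ l)) := by
  rw [entropy, pairing_apply, ← map_sub, int_apply]
  refine setIntegral_congr_fun D.measurableSet_inside fun x hx => ?_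
  simp only [SmoothFun.sub_apply, SmoothFun.sum_apply, mul_apply, ← Finset.sum_sub_distrib]
  refine Finset.sum_congr rfl fun l _ => ?_
  rw [← hφ l x (le_of_lt hx), exp_apply, Real.log_exp]
  ring

theorem entropyProduction_exp {ρ μ : ℝ} {φ u : SmoothPair d} (hN : D.NeumannPair φ)
    (hφ : ∀ l x, D.g x ≤ 0 → exp (φ l) x = u l x) :
    entropyProduction D.inside ρ μ (fun l => (u l : EuclideanSpace ℝ (Fin d) → ℝ)) =
      D.pairing φ (diffOp ρ μ fun l => exp (φ l)) := by
  have h1 : entropyProduction D.inside ρ μ (fun l => (u l : EuclideanSpace ℝ (Fin d) → ℝ)) =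
      D.int (ρ • ∑ l, dot (φ l) (exp (φ l)) +
        μ • ((φ 0 - φ 1) * (exp (φ 0) - exp (φ 1)))) := by
    refine setIntegral_congr_fun D.measurableSet_inside fun x hx => ?_
    have hgrad : ∀ l, ‖gradient (u l) x‖ ^ 2 / u l x = dot (φ l) (exp (φ l)) x := by
      intro l
      have e1 := (dot_congr_left (D.eventuallyEq_of_eqOn (hφ l) hx) (u l)).self_of_nhds
      have e2 := (dot_congr_left (D.eventuallyEq_of_eqOn (hφ l) hx) (φ l)).self_of_nhds
      rw [norm_gradient_sq, ← e1, dot_exp, mul_apply, dot_comm, ← e2, hφ l x (le_of_lt hx),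
        dot_comm (φ l), mul_div_cancel_left₀]
      rw [← hφ l x (le_of_lt hx)]
      exact (Real.exp_pos _).ne'
    simp only [hgrad, SmoothFun.add_apply, SmoothFun.smul_apply, SmoothFun.sum_apply, mul_apply,
      SmoothFun.sub_apply]
    rw [← hφ 0 x (le_of_lt hx), ← hφ 1 x (le_of_lt hx), exp_apply, exp_apply, Real.log_exp,
      Real.log_exp, mul_assoc]
  have a0 := D.int_mul_lap (φ 0) (hN 0).exp
  have a1 := D.int_mul_lap (φ 1) (hN 1).exp
  have key : ∑ l, φ l * diffOp ρ μ (fun l => exp (φ l)) l =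
      (-ρ) • (φ 0 * lap (exp (φ 0)) + φ 1 * lap (exp (φ 1))) +
      μ • ((φ 0 - φ 1) * (exp (φ 0) - exp (φ 1))) := by
    ext x
    simp [diffOp_apply]
    ring
  rw [h1, pairing_apply, key]
  simp only [map_add, map_smul, Fin.sum_univ_two, a0, a1, smul_eq_mul]
  ring

end SmoothDomain

end RKDiffusion

end

theorem theorem6 {d s : ℕ} (Ω : Set (EuclideanSpace ℝ (Fin d)))
    (hΩ_bdd : Bornology.IsBounded Ω) (hΩ_convex : Convex ℝ Ω)
    (hΩ_smooth : RKDiffusion.HasSmoothBoundary Ω)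
    (ρ₁ ρ₂ ρ μ : ℝ) (hρ₁ : ρ₁ = ρ) (hρ₂ : ρ₂ = ρ) (hρ : 0 < ρ) (hμ : 0 < μ)
    (a : Fin s → Fin s → ℝ) (b : Fin s → ℝ) (hb : ∑ i, b i = 1)
    (hC : RKDiffusion.cRK a b = 1)
    (u : RKDiffusion.Pair d) (hu : RKDiffusion.IsSmoothNeumann Ω u)
    (hu_pos : ∀ i, ∀ x ∈ closure Ω, 0 < u i x)
    (hu_steady : ¬ RKDiffusion.IsSteadyState Ω ρ₁ ρ₂ μ u) :
    ∃ τ₀ : ℝ, 0 < τ₀ ∧ ∀ τ : ℝ, 0 < τ → τ < τ₀ →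
      ∀ w : RKDiffusion.Pair d, RKDiffusion.IsSmoothNeumann Ω w →
        (∀ i, ∀ x ∈ Ω, 0 ≤ w i x) →
        RKDiffusion.IsRKStep Ω ρ₁ ρ₂ μ a b τ w u →
        RKDiffusion.entropy Ω u + τ * RKDiffusion.entropyProduction Ω ρ μ u
          ≤ RKDiffusion.entropy Ω w := by
  open RKDiffusion SmoothFun in
  obtain ⟨g, hg⟩ := hΩ_smooth
  obtain ⟨D, rfl, rfl⟩ := hg.exists_smoothDomain hΩ_bdd
  subst ρ₁ ρ₂
  let v : SmoothPair d := fun l => mk (u l) (hu.smooth l)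
  have hv : D.NeumannPair v := D.neumannPair_of_isSmoothNeumann hg hu
  have hlog : ∀ l, ∃ φ : SmoothFun d, ∀ x, D.g x ≤ 0 → exp φ x = v l x := fun l =>
    D.exists_log fun x hx => hu_pos l x (by rw [D.closure_inside]; exact hx)
  choose φ hφ using hlog
  have hφN : D.NeumannPair φ := by
    intro l x hx
    have h1 := D.dot_eq_of_eqOn (hφ l) D.g x hx.le
    rw [hv l x hx, dot_exp, SmoothFun.mul_apply] at h1
    exact (mul_eq_zero.1 h1).resolve_left (Real.exp_pos _).ne'
  have hne : ¬ ∀ l x, D.g x < 0 → diffOp ρ μ (fun l => exp (φ l)) l x = 0 := by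
    intro h
    refine hu_steady fun l x hx => ?_
    have h1 := (diffOp_congr (ρ := ρ) (μ := μ)
      (fun l => D.eventuallyEq_of_eqOn (hφ l) hx) l).self_of_nhds
    exact (systemOp_eq ρ μ v l x).trans (h1.symm.trans (h l x hx))
  obtain ⟨τ₀, hτ₀, hmain⟩ := D.exists_step_entropy_le hΩ_convex hρ hμ hb hC hφN hne
  refine ⟨τ₀, hτ₀, fun τ hτ hlt w hw hw0 hstep => ?_⟩
  obtain ⟨K, hK, hstage, hinc, hend⟩ := hstep
  let w' : SmoothPair d := fun l => mk (w l) (hw.smooth l)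
  let K' : Fin s → SmoothPair d := fun i l => mk (K i l) (hK i l)
  have hst : ∀ i, (fun l => (SmoothDomain.stagePair a τ w' K' i l :
      EuclideanSpace ℝ (Fin d) → ℝ)) = stage a τ w K i := by
    intro i
    funext l x
    simp [SmoothDomain.stagePair, stage, w', K']
  have H : D.IsStep ρ μ a b τ w' (fun l => exp (φ l)) K' := by
    refine ⟨fun i => D.neumannPair_of_isSmoothNeumann hg ?_, fun i l x hx => ?_, fun l x hx => ?_⟩
    · rw [hst]; exact hstage i
    · have h1 := hinc i l x hx
      rw [← hst, systemOp_eq] at h1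
      exact h1
    · rw [hφ l x (le_of_lt hx)]
      have h1 := hend l x hx
      simpa [v, w', K'] using h1
  have h1 := hmain τ hτ hlt w' (fun l x hx => hw0 l x hx) K' H
  have h2 := D.entropy_exp hφ
  have h3 := D.entropyProduction_exp (ρ := ρ) (μ := μ) hφN hφ
  rw [← h2, ← h3] at h1
  exact h1
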